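/- **Conventions.** $\mathbf{LexProf}$ is the bicategory whose objects are small categories with finite limits, with hom-categories $\mathbf{LexProf}(\mathbb A,\mathbb B)=[\mathbb A^{\mathrm{op}},\mathbf{FL}(\mathbb B,\mathbf{Set})]$ (functors $M(i,j)$, contravariant in $i\in\mathbb A$, covariant and finite-limit-preserving in $j\in\mathbb B$), identities $I_{\mathbb A}(i,j)=\mathbb A(i,j)$ and composition $(N\otimes M)(i,k)=\int^{j}N(j,k)\times M(i,j)$. A $\mathbf{LexProf}$-category $\mathcal C$ has objects $X$, each with an extent $\epsilon X\in\mathbf{LexProf}$, hom-objects $\mathcal C(X,Y)\in\mathbf{LexProf}(\epsilon X,\epsilon Y)$, and associative and unital compositions $\mathcal C(Y,Z)\otimes\mathcal C(X,Y)\to\mathcal C(X,Z)$ and identities $\iota_X\colon I_{\epsilon X}\to\mathcal C(X,X)$; $\mathbf{LexProf}$-functors (extent-preserving) and $\mathbf{LexProf}$-transformations are as usual. A map $u\colon W\to\mathcal C(X,Y)$ exhibits $Y$ as the tensor of $X$ by $W$ if $f\mapsto\mu\circ(f\otimes u)$ is a bijection from maps $U\to\mathcal C(Y,Z)$ to maps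 $U\otimes W\to\mathcal C(X,Z)$ for all $Z$ and all $U\in\mathbf{LexProf}(\epsilon Y,\epsilon Z)$; tensors by $W$ are absolute if every $\mathbf{LexProf}$-functor preserves them; $\mathcal C$ is absolute-tensored if it has all absolute tensors. A $\mathbf{LexProf}$-functor $\eta\colon\mathcal C\to\bar{\mathcal C}$ is a free completion under absolute tensors if $\bar{\mathcal C}$ is absolute-tensored and precomposition with $\eta$ is an equivalence $[\bar{\mathcal C},\mathcal E]\simeq[\mathcal C,\mathcal E]$ of categories of $\mathbf{LexProf}$-functors, for every absolute-tensored $\mathcal E$. A left-exact sieve on a category $\mathcal C$ is a collection of finite-limit-preserving functors $\mathbb A\to\mathcal C$ with small finitely complete domain, closed under precomposition with finite-limit-preserving functors and under isomorphism, and such that each object of $\mathcal C$ is in the image of some member; a partially finitely complete category is a category $\mathcal C$ with a left-exact sieve $\mathcal S_{\mathcal C}$ on it. A functor $F\colon\mathcal C\to\mathcal D$ of such is partially finite-limit-preserving if $FX\in\mathcal S_{\mathcal D}$ for all $X\in\mathcal S_{\mathcal C}$, and sieve-reflecting if each $Y\in\mathcal S_{\mathcal D}$ is isomorphic to $FX$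 for some $X\in\mathcal S_{\mathcal C}$. Small finitely complete categories carry the sieve of all finite-limit-preserving functors. For a partially finitely complete $\mathcal C$, the $\mathbf{LexProf}$-category $\Gamma(\mathcal C)$ has as objects of extent $\mathbb A$ the $X\colon\mathbb A\to\mathcal C$ in $\mathcal S_{\mathcal C}$, and $\Gamma(\mathcal C)(X,Y)(i,j)=\mathcal C(Xi,Yj)$. For a $\mathbf{LexProf}$-category $\mathcal C$, the category $\int\mathcal C$ has objects $(X,i)$ with $i\in\epsilon X$ and morphisms $(\int\mathcal C)((X,i),(Y,j))=\mathcal C(X,Y)(i,j)$; with $\iota_X\colon\epsilon X\to\int\mathcal C$, $i\mapsto(X,i)$, it is partially finitely complete via the sieve of all functors isomorphic to some $\iota_YF$ with $F$ finite-limit-preserving. The assignment $\int$ extends to $\mathbf{LexProf}$-functors, and $X\mapsto\iota_X$ gives $\eta_{\mathcal C}\colon\mathcal C\to\Gamma(\int\mathcal C)$. Let $\mathcal A$ be a locally finitely presentable category and $\mathcal A_f$ a small category with a fully faithful functor to $\mathcal A$ whose essential image is the class of finitely presentable objects. Write $\mathbf{Mnd}_f(\mathcal A)$ for the category of filtered-colimit-preserving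 monads on $\mathcal A$. A Lawvere $\mathcal A$-theory is a small category $\mathcal L$ with an identity-on-objects, finite-limit-preserving functor $J\colon\mathcal A_f^{\mathrm{op}}\to\mathcal L$; morphisms are functors commuting with the functors from $\mathcal A_f^{\mathrm{op}}$; they form $\mathbf{Law}(\mathcal A)$. The category $\mathcal L\text{-}\mathbf{Mod}$ has as objects the functors $F\colon\mathcal L\to\mathbf{Set}$ such that $FJ$ preserves finite limits, and all natural transformations. A Lawvere $\mathbf{LexProf}$-category over $\mathcal A$ is a partially finitely complete category $\mathcal L$ with an identity-on-objects, sieve-reflecting, partially finite-limit-preserving functor $J\colon\mathcal A_f^{\mathrm{op}}\to\mathcal L$; morphisms are commuting triangles of partially finite-limit-preserving functors. **Theorem.** Let $\mathcal A$ be locally finitely presentable. 1. For every $\mathbf{LexProf}$-category $\mathcal T$ with a single object, of extent $\mathcal A_f^{\mathrm{op}}$, the $\mathbf{LexProf}$-functor $\eta_{\mathcal T}\colon\mathcal T\to\Gamma(\int\mathcal T)$ is the free completion of $\mathcal T$ under absolute tensors. 2. The following functors are equivalences of categories: (a) the functor from $\mathbf{Mnd}_f(\mathcal A)$ to the category of $\mathbf{LexProf}$-categories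 with a single object of extent $\mathcal A_f^{\mathrm{op}}$, sending $T$ to the one-object $\mathbf{LexProf}$-category with hom $(i,j)\mapsto\mathcal A(j,Ti)$, with Kleisli composition and with identities given by the unit of $T$; (b) the functor from one-object $\mathbf{LexProf}$-categories of extent $\mathcal A_f^{\mathrm{op}}$ to Lawvere $\mathbf{LexProf}$-categories over $\mathcal A$, sending $\mathcal T$ to $\int !\colon\mathcal A_f^{\mathrm{op}}\cong\int\mathcal I\to\int\mathcal T$, where $\mathcal I$ is the $\mathbf{LexProf}$-category with one object $\star$ of extent $\mathcal A_f^{\mathrm{op}}$ and hom $I_{\mathcal A_f^{\mathrm{op}}}$, $\,!\colon\mathcal I\to\mathcal T$ is the unique $\mathbf{LexProf}$-functor, and the object $(\star,i)$ of $\int\mathcal T$ is renamed to $i$; (c) the functor from Lawvere $\mathbf{LexProf}$-categories over $\mathcal A$ to $\mathbf{Law}(\mathcal A)$ that forgets the sieve. In particular, their composite $\Phi\colon\mathbf{Mnd}_f(\mathcal A)\to\mathbf{Law}(\mathcal A)$ is an equivalence. 3. The functors $(-)\text{-}\mathbf{Alg}\colon\mathbf{Mnd}_f(\mathcal A)^{\mathrm{op}}\to\mathbf{CAT}$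 (Eilenberg–Moore algebras) and $(-)\text{-}\mathbf{Mod}\circ\Phi^{\mathrm{op}}\colon\mathbf{Mnd}_f(\mathcal A)^{\mathrm{op}}\to\mathbf{CAT}$ are pseudonaturally equivalent. -/

import Mathlib

open CategoryTheory Limits Opposite

universe v u u'

namespace LexEnriched

/-! ### Small finitely complete categories and lex profunctors -/

/-- A small category with finite limits. -/
structure FLCat : Type (v + 1) where
  carrier : Type v
  [cat : SmallCategory carrier]
  [lim : HasFiniteLimits carrier]

attribute [instance] FLCat.cat FLCat.lim

instance : CoeSort FLCat.{v} (Type v) := ⟨FLCat.carrier⟩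

/-- The hom-category of lex profunctors from `A` to `B`: the functor category
`[Aᵒᵖ, FL(B, Set)]`. -/
abbrev LexProf (A B : FLCat.{v}) := Aᵒᵖ ⥤ (B ⥤ₗ Type v)

namespace LexProf

variable {A B C : FLCat.{v}}

/-- The set `M(i, j)`. -/
abbrev El (M : LexProf A B) (i : A) (j : B) : Type v := (M.obj (op i)).obj.obj j

/-- The contravariant action of a lex profunctor in its first variable. -/
def lmap (M : LexProf A B) {i' i : A} (φ : i' ⟶ i) {j : B} (x : M.El i j) : M.El i' j :=
  (M.map φ.op).hom.app j x

/-- The covariant action of a lex profunctor in its second variable. -/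
def rmap (M : LexProf A B) {i : A} {j j' : B} (ψ : j ⟶ j') (x : M.El i j) : M.El i j' :=
  (M.obj (op i)).obj.map ψ x

/-- The components of a map of lex profunctors. -/
def ap {M N : LexProf A B} (f : M ⟶ N) {i : A} {j : B} (x : M.El i j) : N.El i j :=
  (f.app (op i)).hom.app j x

@[simp] lemma lmap_id (M : LexProf A B) {i : A} {j : B} (x : M.El i j) :
    M.lmap (𝟙 i) x = x := by
  simp [lmap]

lemma lmap_comp (M : LexProf A B) {i₁ i₂ i₃ : A} (φ : i₁ ⟶ i₂) (φ' : i₂ ⟶ i₃) {j : B}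
    (x : M.El i₃ j) : M.lmap (φ ≫ φ') x = M.lmap φ (M.lmap φ' x) := by
  simp [lmap]

@[simp] lemma rmap_id (M : LexProf A B) {i : A} {j : B} (x : M.El i j) :
    M.rmap (𝟙 j) x = x := by
  simp [rmap]

lemma rmap_comp (M : LexProf A B) {i : A} {j₁ j₂ j₃ : B} (ψ : j₁ ⟶ j₂) (ψ' : j₂ ⟶ j₃)
    (x : M.El i j₁) : M.rmap (ψ ≫ ψ') x = M.rmap ψ' (M.rmap ψ x) := by
  simp [rmap]

lemma ap_lmap {M N : LexProf A B} (f : M ⟶ N) {i' i : A} (φ : i' ⟶ i) {j : B} (x : M.El i j) :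
    ap f (M.lmap φ x) = N.lmap φ (ap f x) :=
  congrArg (fun t => t.hom.app j x) (f.naturality φ.op)

lemma ap_rmap {M N : LexProf A B} (f : M ⟶ N) {i : A} {j j' : B} (ψ : j ⟶ j') (x : M.El i j) :
    ap f (M.rmap ψ x) = N.rmap ψ (ap f x) :=
  congrArg (fun t => t x) ((f.app (op i)).hom.naturality ψ)

@[simp] lemma ap_id {M : LexProf A B} {i : A} {j : B} (x : M.El i j) : ap (𝟙 M) x = x := rfl

@[simp] lemma ap_comp {M N P : LexProf A B} (f : M ⟶ N) (g : N ⟶ P) {i : A} {j : B}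
    (x : M.El i j) : ap (f ≫ g) x = ap g (ap f x) := rfl

/-- A map of lex profunctors from its components. -/
def homMk {M N : LexProf A B} (f : ∀ {i : A} {j : B}, M.El i j → N.El i j)
    (hl : ∀ {i' i : A} (φ : i' ⟶ i) {j : B} (x : M.El i j), f (M.lmap φ x) = N.lmap φ (f x))
    (hr : ∀ {i : A} {j j' : B} (ψ : j ⟶ j') (x : M.El i j), f (M.rmap ψ x) = N.rmap ψ (f x)) :
    M ⟶ N where
  app i := ObjectProperty.homMk
    { app := fun j => TypeCat.ofHom (fun x : M.El i.unop j => f x)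
      naturality := fun j j' ψ => by
        ext x
        exact hr (i := i.unop) ψ x }
  naturality i i' φ := by
    ext j x
    exact hl φ.unop x

@[simp] lemma ap_homMk {M N : LexProf A B} (f : ∀ {i : A} {j : B}, M.El i j → N.El i j) (hl hr)
    {i : A} {j : B} (x : M.El i j) : ap (homMk (M := M) (N := N) f hl hr) x = f x := rfl

lemma hom_ext {M N : LexProf A B} {f g : M ⟶ N}
    (h : ∀ (i : A) (j : B) (x : M.El i j), ap f x = ap g x) : f = g := by
  ext i j x
  exact h i.unop j x

/-- The identity lex profunctor `I_A(i, j) = A(i, j)`. -/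
abbrev unit (A : FLCat.{v}) : LexProf A A where
  obj i := ⟨coyoneda.obj i, by
    simp only [leftExactFunctor_iff]; infer_instance⟩
  map φ := ObjectProperty.homMk (coyoneda.map φ)

/-- A `2`-cell `N ⊗ M ⟶ P` of lex profunctors, where `M : A ⇸ B`, `N : B ⇸ C` and `P : A ⇸ C`.
As `(N ⊗ M)(i, k)` is the coend `∫^j N(j, k) × M(i, j)`, such a `2`-cell amounts to
functions `M(i, j) × N(j, k) → P(i, k)` natural in `i` and `k` and dinatural in `j`. -/
@[ext]
structure Bimor (M : LexProf A B) (N : LexProf B C) (P : LexProf A C) where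
  fn : ∀ {i : A} {j : B} {k : C}, M.El i j → N.El j k → P.El i k
  fn_lmap : ∀ {i' i : A} {j : B} {k : C} (φ : i' ⟶ i) (x : M.El i j) (y : N.El j k),
    fn (M.lmap φ x) y = P.lmap φ (fn x y)
  fn_rmap : ∀ {i : A} {j : B} {k k' : C} (χ : k ⟶ k') (x : M.El i j) (y : N.El j k),
    fn x (N.rmap χ y) = P.rmap χ (fn x y)
  dinatural : ∀ {i : A} {j j' : B} {k : C} (ψ : j ⟶ j') (x : M.El i j) (y : N.El j' k),
    fn (M.rmap ψ x) y = fn x (N.lmap ψ y)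

/-- The composite of `g ⊗ f : N ⊗ M ⟶ N' ⊗ M'` with a `2`-cell `N' ⊗ M' ⟶ P`. -/
def Bimor.precomp {M M' : LexProf A B} {N N' : LexProf B C} {P : LexProf A C}
    (b : Bimor M' N' P) (f : M ⟶ M') (g : N ⟶ N') : Bimor M N P where
  fn x y := b.fn (ap f x) (ap g y)
  fn_lmap φ x y := by rw [ap_lmap, b.fn_lmap]
  fn_rmap χ x y := by rw [ap_rmap, b.fn_rmap]
  dinatural ψ x y := by rw [ap_rmap, ap_lmap, b.dinatural]

end LexProf

open LexProf

/-! ### Categories enriched in the bicategory of lex profunctors -/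

/-- A category enriched in the bicategory of lex profunctors. The objects of extent `A` form the
type `Obj A`. -/
structure LexProfCat where
  Obj : FLCat.{v} → Type (v + 1)
  hom : ∀ {A B : FLCat.{v}}, Obj A → Obj B → LexProf A B
  comp : ∀ {A B C : FLCat.{v}} (X : Obj A) (Y : Obj B) (Z : Obj C),
    Bimor (hom X Y) (hom Y Z) (hom X Z)
  ident : ∀ {A : FLCat.{v}} (X : Obj A), LexProf.unit A ⟶ hom X X
  id_comp : ∀ {A B : FLCat.{v}} (X : Obj A) (Y : Obj B) {i : A} {j : B} (f : (hom X Y).El i j),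
    (comp X X Y).fn (ap (ident X) (𝟙 i)) f = f
  comp_id : ∀ {A B : FLCat.{v}} (X : Obj A) (Y : Obj B) {i : A} {j : B} (f : (hom X Y).El i j),
    (comp X Y Y).fn f (ap (ident Y) (𝟙 j)) = f
  assoc : ∀ {A B C D : FLCat.{v}} (X : Obj A) (Y : Obj B) (Z : Obj C) (W : Obj D)
    {i : A} {j : B} {k : C} {l : D}
    (f : (hom X Y).El i j) (g : (hom Y Z).El j k) (h : (hom Z W).El k l),
    (comp X Z W).fn ((comp X Y Z).fn f g) h = (comp X Y W).fn f ((comp Y Z W).fn g h)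

namespace LexProfCat

variable (C : LexProfCat.{v})

/-- The functions `ι_X : A(i, j) → C(X, X)(i, j)` underlying the identities. -/
def idMap {A : FLCat.{v}} (X : C.Obj A) {i j : A} (φ : i ⟶ j) : (C.hom X X).El i j :=
  ap (C.ident X) (show (LexProf.unit A).El i j from φ)

/-- The element `1_{X,i}` of `C(X, X)(i, i)`. -/
abbrev one {A : FLCat.{v}} (X : C.Obj A) (i : A) : (C.hom X X).El i i :=
  C.idMap X (𝟙 i)

lemma rmap_idMap {A : FLCat.{v}} (X : C.Obj A) {i j k : A} (φ : i ⟶ j) (ψ : j ⟶ k) :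
    (C.hom X X).rmap ψ (C.idMap X φ) = C.idMap X (φ ≫ ψ) :=
  (ap_rmap (C.ident X) ψ (show (LexProf.unit A).El i j from φ)).symm

lemma lmap_idMap {A : FLCat.{v}} (X : C.Obj A) {i j k : A} (φ : i ⟶ j) (ψ : j ⟶ k) :
    (C.hom X X).lmap φ (C.idMap X ψ) = C.idMap X (φ ≫ ψ) :=
  (ap_lmap (C.ident X) φ (show (LexProf.unit A).El j k from ψ)).symm

lemma comp_idMap {A B : FLCat.{v}} (X : C.Obj A) (Y : C.Obj B) {i : A} {j j' : B}
    (f : (C.hom X Y).El i j) (ψ : j ⟶ j') :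
    (C.comp X Y Y).fn f (C.idMap Y ψ) = (C.hom X Y).rmap ψ f := by
  rw [← Category.id_comp ψ, ← rmap_idMap, (C.comp X Y Y).fn_rmap]
  rw [Category.id_comp]
  exact congrArg _ (C.comp_id X Y f)

lemma idMap_comp {A B : FLCat.{v}} (X : C.Obj A) (Y : C.Obj B) {i' i : A} {j : B}
    (φ : i' ⟶ i) (f : (C.hom X Y).El i j) :
    (C.comp X X Y).fn (C.idMap X φ) f = (C.hom X Y).lmap φ f := by
  rw [← Category.comp_id φ, ← lmap_idMap, (C.comp X X Y).fn_lmap]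
  rw [Category.comp_id]
  exact congrArg _ (C.id_comp X Y f)

lemma idMap_map_comp {A : FLCat.{v}} (X : C.Obj A) {i j k : A} (φ : i ⟶ j) (ψ : j ⟶ k) :
    C.idMap X (φ ≫ ψ) = (C.comp X X X).fn (C.idMap X φ) (C.idMap X ψ) := by
  rw [comp_idMap, rmap_idMap]

end LexProfCat

/-- Functors of categories enriched in lex profunctors. -/
@[ext]
structure LexProfFunctor (C D : LexProfCat.{v}) where
  obj : ∀ {A : FLCat.{v}}, C.Obj A → D.Obj A
  map : ∀ {A B : FLCat.{v}} (X : C.Obj A) (Y : C.Obj B), C.hom X Y ⟶ D.hom (obj X) (obj Y)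
  map_ident : ∀ {A : FLCat.{v}} (X : C.Obj A), C.ident X ≫ map X X = D.ident (obj X)
  map_comp : ∀ {A B E : FLCat.{v}} (X : C.Obj A) (Y : C.Obj B) (Z : C.Obj E)
    {i : A} {j : B} {k : E} (f : (C.hom X Y).El i j) (g : (C.hom Y Z).El j k),
    ap (map X Z) ((C.comp X Y Z).fn f g) =
      (D.comp (obj X) (obj Y) (obj Z)).fn (ap (map X Y) f) (ap (map Y Z) g)

namespace LexProfFunctor

variable {C D E : LexProfCat.{v}}

lemma ap_idMap (F : LexProfFunctor C D) {A : FLCat.{v}} (X : C.Obj A) {i j : A} (φ : i ⟶ j) :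
    ap (F.map X X) (C.idMap X φ) = D.idMap (F.obj X) φ :=
  congrArg (fun t => ap t (show (LexProf.unit A).El i j from φ)) (F.map_ident X)

/-- The identity functor. -/
def id (C : LexProfCat.{v}) : LexProfFunctor C C where
  obj X := X
  map _ _ := 𝟙 _
  map_ident _ := rfl
  map_comp _ _ _ _ _ _ _ _ := rfl

/-- Composition of functors. -/
def comp (F : LexProfFunctor C D) (G : LexProfFunctor D E) : LexProfFunctor C E where
  obj X := G.obj (F.obj X)
  map X Y := F.map X Y ≫ G.map (F.obj X) (F.obj Y)
  map_ident X := by rw [← Category.assoc, F.map_ident, G.map_ident]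
  map_comp X Y Z i j k f g := by simp only [ap_comp, F.map_comp, G.map_comp]

/-- Transformations of functors enriched in lex profunctors. The component
`I_A ⟶ D(FX, GX)` at `X` is given, by the Yoneda lemma, by the images of the identities, that is, by
elements of `D(FX, GX)(i, i)`; their naturality in `i` is part of the enriched naturality. -/
@[ext]
structure Trans (F G : LexProfFunctor C D) where
  app : ∀ {A : FLCat.{v}} (X : C.Obj A) (i : A), (D.hom (F.obj X) (G.obj X)).El i i
  naturality : ∀ {A B : FLCat.{v}} (X : C.Obj A) (Y : C.Obj B) {i : A} {j : B}
    (f : (C.hom X Y).El i j),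
    (D.comp (F.obj X) (F.obj Y) (G.obj Y)).fn (ap (F.map X Y) f) (app Y j) =
      (D.comp (F.obj X) (G.obj X) (G.obj Y)).fn (app X i) (ap (G.map X Y) f)

/-- The category of enriched functors and transformations. -/
instance : Category (LexProfFunctor C D) where
  Hom F G := Trans F G
  id F :=
    { app := fun X i => D.one (F.obj X) i
      naturality := fun X Y i j f => by exact (D.comp_id _ _ _).trans (D.id_comp _ _ _).symm }
  comp {F G H} α β :=
    { app := fun X i => (D.comp (F.obj X) (G.obj X) (H.obj X)).fn (α.app X i) (β.app X i)
      naturality := fun X Y i j f => by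
        rw [← D.assoc, α.naturality, D.assoc, β.naturality, D.assoc] }
  id_comp α := Trans.ext (by funext A X i; exact D.id_comp _ _ _)
  comp_id α := Trans.ext (by funext A X i; exact D.comp_id _ _ _)
  assoc α β γ := Trans.ext (by funext A X i; exact D.assoc _ _ _ _ _ _ _)

/-- Precomposition with an enriched functor. -/
def precomp (F : LexProfFunctor C D) (E : LexProfCat.{v}) :
    LexProfFunctor D E ⥤ LexProfFunctor C E where
  obj G := F.comp G
  map α :=
    { app := fun X i => α.app (F.obj X) i
      naturality := fun X Y _ _ f => α.naturality (F.obj X) (F.obj Y) (ap (F.map X Y) f) }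
  map_id _ := rfl
  map_comp _ _ := rfl

end LexProfFunctor

/-! ### Absolute tensors -/

namespace LexProfCat

/-- `u : W ⟶ C(X, Y)` exhibits `Y` as the tensor of `X` by the lex profunctor `W`. -/
def IsTensor (C : LexProfCat.{v}) {A B : FLCat.{v}} (W : LexProf A B) (X : C.Obj A) (Y : C.Obj B)
    (u : W ⟶ C.hom X Y) : Prop :=
  ∀ {E : FLCat.{v}} (U : LexProf B E) (Z : C.Obj E),
    Function.Bijective
      (fun f : U ⟶ C.hom Y Z => ((C.comp X Y Z).precomp u f : Bimor W U (C.hom X Z)))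

end LexProfCat

/-- Tensors by `W` are absolute: every enriched functor preserves them. -/
def LexProf.IsAbsolute {A B : FLCat.{v}} (W : LexProf A B) : Prop :=
  ∀ (C D : LexProfCat.{v}) (F : LexProfFunctor C D) (X : C.Obj A) (Y : C.Obj B)
    (u : W ⟶ C.hom X Y), C.IsTensor W X Y u →
      D.IsTensor W (F.obj X) (F.obj Y) (u ≫ F.map X Y)

/-- All absolute tensors exist. -/
def LexProfCat.IsAbsoluteTensored (C : LexProfCat.{v}) : Prop :=
  ∀ {A B : FLCat.{v}} (W : LexProf A B), W.IsAbsolute →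
    ∀ X : C.Obj A, ∃ (Y : C.Obj B) (u : W ⟶ C.hom X Y), C.IsTensor W X Y u

/-- `F : C ⟶ D` exhibits `D` as the free completion of `C` under absolute tensors. (Absolute tensors
are preserved by all enriched functors, so no preservation condition is needed.) -/
structure LexProfFunctor.IsFreeAbsoluteCompletion {C D : LexProfCat.{v}}
    (F : LexProfFunctor C D) : Prop where
  tensored : D.IsAbsoluteTensored
  universal : ∀ E : LexProfCat.{v}, E.IsAbsoluteTensored → (F.precomp E).IsEquivalence

/-! ### Partially finitely complete categories -/

/-- A left-exact sieve on a category. A partially finitely complete category is a category together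
with a left-exact sieve on it. -/
structure LeftExactSieve (C : Type u) [Category.{v} C] where
  mem : ∀ {A : FLCat.{v}}, (A ⥤ C) → Prop
  lex : ∀ {A : FLCat.{v}} {X : A ⥤ C}, mem X → PreservesFiniteLimits X
  precomp : ∀ {A B : FLCat.{v}} {X : B ⥤ C} (G : A ⥤ B), PreservesFiniteLimits G →
    mem X → mem (G ⋙ X)
  iso : ∀ {A : FLCat.{v}} {X Y : A ⥤ C}, (X ≅ Y) → mem X → mem Y
  cover : ∀ c : C, ∃ (A : FLCat.{v}) (X : A ⥤ C), mem X ∧ ∃ a : A, X.obj a = c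

namespace LeftExactSieve

variable {C : Type u} [Category.{v} C] {D : Type u'} [Category.{v} D]

/-- Partially finite-limit-preserving functors. -/
def IsPartiallyLex (S : LeftExactSieve C) (S' : LeftExactSieve D) (F : C ⥤ D) : Prop :=
  ∀ {A : FLCat.{v}} {X : A ⥤ C}, S.mem X → S'.mem (X ⋙ F)

/-- Sieve-reflecting functors. -/
def IsReflecting (S : LeftExactSieve C) (S' : LeftExactSieve D) (F : C ⥤ D) : Prop :=
  ∀ {A : FLCat.{v}} {Y : A ⥤ D}, S'.mem Y → ∃ X : A ⥤ C, S.mem X ∧ Nonempty (X ⋙ F ≅ Y)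

/-- The sieve of all finite-limit-preserving functors with small domain into a small
finitely complete category. -/
def maximal (A : FLCat.{v}) : LeftExactSieve A where
  mem X := PreservesFiniteLimits X
  lex h := h
  precomp _ _ _ := inferInstance
  iso e h := by
    have := h
    exact preservesFiniteLimits_of_natIso e
  cover a := ⟨A, 𝟭 _, inferInstance, a, rfl⟩

end LeftExactSieve

/-- A functor is finite-limit-preserving if its composites with all covariant representables
are. -/
lemma preservesFiniteLimits_of_coyoneda {A : FLCat.{v}} {D : Type u} [Category.{v} D]
    (F : A ⥤ D) (h : ∀ d : D, PreservesFiniteLimits (F ⋙ coyoneda.obj (op d))) :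
    PreservesFiniteLimits F where
  preservesFiniteLimits J _ _ :=
    ⟨fun {K} => ⟨fun {c} hc => ⟨coyonedaJointlyReflectsLimits _ _ fun d => by
      have := h d.unop
      exact isLimitOfPreserves (F ⋙ coyoneda.obj d) hc⟩⟩⟩

/-- The enriched category `Γ(C)` of a partially finitely complete category `(C, S)`: the objects
of extent `A` are the functors `A ⥤ C` in the sieve, and `Γ(C)(X, Y)(i, j) = C(X i, Y j)`. -/
def Γ {C : Type (v + 1)} [Category.{v} C] (S : LeftExactSieve C) : LexProfCat.{v} where
  Obj A := { X : A ⥤ C // S.mem X }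
  hom {A B} X Y :=
    { obj := fun i => ⟨Y.1 ⋙ coyoneda.obj (op (X.1.obj i.unop)), by
        have := S.lex Y.2
        simp only [leftExactFunctor_iff]
        infer_instance⟩
      map := fun φ => ObjectProperty.homMk
        (Functor.whiskerLeft Y.1 (coyoneda.map (X.1.map φ.unop).op)) }
  comp {A B E} X Y Z :=
    { fn := fun {i j k} (f : X.1.obj i ⟶ Y.1.obj j) (g : Y.1.obj j ⟶ Z.1.obj k) => f ≫ g
      fn_lmap := fun _ _ _ => Category.assoc _ _ _
      fn_rmap := fun _ _ _ => (Category.assoc _ _ _).symm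
      dinatural := fun _ _ _ => Category.assoc _ _ _ }
  ident X := homMk (fun {i j} (φ : i ⟶ j) => X.1.map φ)
    (fun _ _ _ => X.1.map_comp _ _) (fun _ _ => X.1.map_comp _ _)
  id_comp X Y i j f := by
    change X.1.map (𝟙 i) ≫ (show X.1.obj i ⟶ Y.1.obj j from f) = f
    simp
  comp_id X Y i j f := by
    change (show X.1.obj i ⟶ Y.1.obj j from f) ≫ Y.1.map (𝟙 j) = f
    simp
  assoc X Y Z W i j k l f g h := Category.assoc
    (show X.1.obj i ⟶ Y.1.obj j from f) (show Y.1.obj j ⟶ Z.1.obj k from g)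
    (show Z.1.obj k ⟶ W.1.obj l from h)

/-! ### The construction `∫` -/

/-- The objects `(X, i)` of the category `∫ C`, where `X` has extent `A` and `i` is an object
of `A`. -/
structure IntCat (C : LexProfCat.{v}) : Type (v + 1) where
  ext : FLCat.{v}
  obj : C.Obj ext
  pt : ext

namespace IntCat

variable {C D : LexProfCat.{v}}

/-- The category `∫ C`, with `(∫ C)((X, i), (Y, j)) = C(X, Y)(i, j)`. -/
instance : Category.{v} (IntCat C) where
  Hom p q := (C.hom p.obj q.obj).El p.pt q.pt
  id p := C.one p.obj p.pt
  comp f g := (C.comp _ _ _).fn f g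
  id_comp f := C.id_comp _ _ f
  comp_id f := C.comp_id _ _ f
  assoc f g h := C.assoc _ _ _ _ f g h

/-- The functor `ι_X : A ⥤ ∫ C` for `X` of extent `A`. -/
def ι {A : FLCat.{v}} (X : C.Obj A) : A ⥤ IntCat C where
  obj i := ⟨A, X, i⟩
  map φ := C.idMap X φ
  map_id _ := rfl
  map_comp φ ψ := C.idMap_map_comp X φ ψ

lemma ι_lex {A : FLCat.{v}} (X : C.Obj A) : PreservesFiniteLimits (ι X) :=
  preservesFiniteLimits_of_coyoneda _ fun p => by
    have : PreservesFiniteLimits ((C.hom p.obj X).obj (op p.pt)).obj :=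
      ((C.hom p.obj X).obj (op p.pt)).property
    refine preservesFiniteLimits_of_natIso
      (NatIso.ofComponents (fun j => Iso.refl _) ?_ :
        ((C.hom p.obj X).obj (op p.pt)).obj ≅ ι X ⋙ coyoneda.obj (op p))
    intro j j' ψ
    ext f
    exact (C.comp_idMap p.obj X f ψ).symm

/-- The left-exact sieve of all functors isomorphic to some `ι_Y ∘ F` with `F` preserving finite
limits, making `∫ C` a partially finitely complete category. -/
def sieve (C : LexProfCat.{v}) : LeftExactSieve (IntCat C) where
  mem {A} G := ∃ (B : FLCat.{v}) (Y : C.Obj B) (F : A ⥤ B),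
    PreservesFiniteLimits F ∧ Nonempty (G ≅ F ⋙ ι Y)
  lex := by
    rintro A X ⟨B, Y, F, hF, ⟨e⟩⟩
    have := ι_lex Y
    exact preservesFiniteLimits_of_natIso e.symm
  precomp := by
    rintro A A' X G hG ⟨B, Y, F, hF, ⟨e⟩⟩
    exact ⟨B, Y, G ⋙ F, inferInstance, ⟨Functor.isoWhiskerLeft G e⟩⟩
  iso := by
    rintro A X X' i ⟨B, Y, F, hF, ⟨e⟩⟩
    exact ⟨B, Y, F, hF, ⟨i.symm ≪≫ e⟩⟩
  cover p := ⟨p.ext, ι p.obj, ⟨p.ext, p.obj, 𝟭 _, inferInstance, ⟨Iso.refl _⟩⟩, p.pt, rfl⟩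

/-- The action of `∫` on enriched functors. -/
def map (F : LexProfFunctor C D) : IntCat C ⥤ IntCat D where
  obj p := ⟨p.ext, F.obj p.obj, p.pt⟩
  map {p q} f := ap (F.map p.obj q.obj) f
  map_id p := F.ap_idMap p.obj (𝟙 p.pt)
  map_comp f g := F.map_comp _ _ _ f g

lemma ι_map (F : LexProfFunctor C D) {A : FLCat.{v}} (X : C.Obj A) :
    ι X ⋙ map F = ι (F.obj X) :=
  CategoryTheory.Functor.ext (fun _ => rfl) (fun i j φ => by
    refine (F.ap_idMap X φ).trans ?_
    change (ι (F.obj X)).map φ = 𝟙 _ ≫ (ι (F.obj X)).map φ ≫ 𝟙 _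
    rw [Category.id_comp, Category.comp_id])

lemma map_isPartiallyLex (F : LexProfFunctor C D) :
    (sieve C).IsPartiallyLex (sieve D) (map F) := by
  rintro A X ⟨B, Y, G, hG, ⟨e⟩⟩
  refine ⟨B, F.obj Y, G, hG, ⟨?_⟩⟩
  rw [← ι_map]
  exact Functor.isoWhiskerRight e (map F)

end IntCat

/-- The enriched functor `C ⟶ Γ(∫ C)`, the unit of the adjunction between `∫` and `Γ`: it sends
`X` to `ι_X` and is the identity on homs. -/
def unitΓ (C : LexProfCat.{v}) : LexProfFunctor C (Γ (IntCat.sieve C)) where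
  obj {A} X := ⟨IntCat.ι X, A, X, 𝟭 _, inferInstance, ⟨Iso.refl _⟩⟩
  map X Y := homMk (fun f => f)
    (fun φ _ f => (C.idMap_comp X Y φ f).symm) (fun ψ f => (C.comp_idMap X Y f ψ).symm)
  map_ident _ := rfl
  map_comp _ _ _ _ _ _ _ _ := rfl

/-! ### One-object enriched categories -/

/-- An enriched category with a single object, of extent `A`. -/
structure OneObjCat (A : FLCat.{v}) where
  cat : LexProfCat.{v}
  star : cat.Obj A
  eq_star : ∀ {B : FLCat.{v}} (X : cat.Obj B), (⟨B, X⟩ : Σ B, cat.Obj B) = ⟨A, star⟩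

/-- The category of one-object enriched categories of extent `A` and all enriched functors. -/
instance (A : FLCat.{v}) : Category (OneObjCat A) where
  Hom T T' := LexProfFunctor T.cat T'.cat
  id T := LexProfFunctor.id T.cat
  comp F G := F.comp G

namespace OneObjCat

variable {A : FLCat.{v}}

lemma obj_star {T T' : OneObjCat A} (F : T ⟶ T') :
    LexProfFunctor.obj F T.star = T'.star :=
  eq_of_heq (Sigma.mk.inj (T'.eq_star _)).2

/-- The family of objects with a single member, of extent `A`. -/
inductive Star (A : FLCat.{v}) : FLCat.{v} → Type (v + 1)
  | star : Star A A

/-- The hom-objects of a one-object enriched category. -/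
def Star.hom (T : LexProf A A) : ∀ {B C : FLCat.{v}}, Star A B → Star A C → LexProf B C
  | _, _, .star, .star => T

/-- The one-object enriched category of a monad in the bicategory of lex profunctors. -/
def ofMonad (T : LexProf A A) (mul : Bimor T T T) (unit : LexProf.unit A ⟶ T)
    (one_mul : ∀ {i j : A} (f : T.El i j), mul.fn (ap unit (𝟙 i)) f = f)
    (mul_one : ∀ {i j : A} (f : T.El i j), mul.fn f (ap unit (𝟙 j)) = f)
    (assoc : ∀ {i j k l : A} (f : T.El i j) (g : T.El j k) (h : T.El k l),
      mul.fn (mul.fn f g) h = mul.fn f (mul.fn g h)) : OneObjCat A where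
  cat :=
    { Obj := Star A
      hom := Star.hom T
      comp := @fun _ _ _ X Y Z => by
        cases X; cases Y; cases Z; exact mul
      ident := @fun _ X => by
        cases X; exact unit
      id_comp := @fun _ _ X Y => by
        cases X; cases Y; exact one_mul
      comp_id := @fun _ _ X Y => by
        cases X; cases Y; exact mul_one
      assoc := @fun _ _ _ _ X Y Z W => by
        cases X; cases Y; cases Z; cases W; exact assoc }
  star := .star
  eq_star X := by cases X; rfl

/-- The functor between the one-object enriched categories of two monads induced by a map of
monads. -/
def ofMonadMap {T T' : LexProf A A} {mul unit one_mul mul_one assoc}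
    {mul' unit' one_mul' mul_one' assoc'} (θ : T ⟶ T')
    (hunit : unit ≫ θ = unit')
    (hmul : ∀ {i j k : A} (f : T.El i j) (g : T.El j k),
      ap θ (mul.fn f g) = mul'.fn (ap θ f) (ap θ g)) :
    ofMonad T mul unit one_mul mul_one assoc ⟶
      ofMonad T' mul' unit' one_mul' mul_one' assoc' :=
  show LexProfFunctor _ _ from
  { obj := fun X => X
    map := @fun _ _ X Y => by
      cases X; cases Y; exact θ
    map_ident := @fun _ X => by
      cases X; exact hunit
    map_comp := @fun _ _ _ X Y Z => by
      cases X; cases Y; cases Z; exact hmul }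

lemma ofMonadMap_eq_id {T : LexProf A A} {mul unit one_mul mul_one assoc} (θ : T ⟶ T)
    (hunit hmul) (h : θ = 𝟙 T) :
    (ofMonadMap θ hunit hmul : ofMonad T mul unit one_mul mul_one assoc ⟶
      ofMonad T mul unit one_mul mul_one assoc) = 𝟙 _ := by
  subst h
  refine LexProfFunctor.ext rfl (heq_of_eq ?_)
  funext B C X Y
  cases X
  cases Y
  rfl

lemma ofMonadMap_eq_comp {T T' T'' : LexProf A A} {mul unit one_mul mul_one assoc}
    {mul' unit' one_mul' mul_one' assoc'} {mul'' unit'' one_mul'' mul_one'' assoc''}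
    (θ : T ⟶ T') (θ' : T' ⟶ T'') (θ'' : T ⟶ T'') (hunit hmul hunit' hmul' hunit'' hmul'')
    (h : θ'' = θ ≫ θ') :
    (ofMonadMap θ'' hunit'' hmul'' : ofMonad T mul unit one_mul mul_one assoc ⟶
      ofMonad T'' mul'' unit'' one_mul'' mul_one'' assoc'') =
    (ofMonadMap θ hunit hmul : ofMonad T mul unit one_mul mul_one assoc ⟶
      ofMonad T' mul' unit' one_mul' mul_one' assoc') ≫ ofMonadMap θ' hunit' hmul' := by
  subst h
  refine LexProfFunctor.ext rfl (heq_of_eq ?_)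
  funext B C X Y
  cases X
  cases Y
  rfl

/-- The unit enriched category `I_A`, with a single object of extent `A` and with the identity lex
profunctor as its hom. -/
def unitCat (A : FLCat.{v}) : OneObjCat A :=
  ofMonad (LexProf.unit A)
    { fn := fun {i j k} (f : i ⟶ j) (g : j ⟶ k) => f ≫ g
      fn_lmap := fun _ _ _ => Category.assoc _ _ _
      fn_rmap := fun _ _ _ => (Category.assoc _ _ _).symm
      dinatural := fun _ _ _ => Category.assoc _ _ _ }
    (𝟙 _) (fun _ => Category.id_comp _) (fun _ => Category.comp_id _)
    (fun _ _ _ => Category.assoc _ _ _)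

/-- The unique enriched functor from the unit enriched category to a one-object enriched
category. -/
def bang (T : OneObjCat A) : unitCat A ⟶ T :=
  show LexProfFunctor _ _ from
  { obj := @fun _ X => by
      cases X; exact T.star
    map := @fun _ _ X Y => by
      cases X; cases Y; exact T.cat.ident T.star
    map_ident := @fun _ X => by
      cases X; exact Category.id_comp _
    map_comp := @fun _ _ _ X Y Z => by
      cases X; cases Y; cases Z; exact fun f g => T.cat.idMap_map_comp T.star f g }

/-- The functor `∫ ! : A ≅ ∫ I_A ⥤ ∫ T`, where `A ≅ ∫ I_A` is the identification of `i` with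
`(⋆, i)`. -/
def J (T : OneObjCat A) : A ⥤ IntCat T.cat :=
  IntCat.ι (unitCat A).star ⋙ IntCat.map (bang T)

lemma J_eq (T : OneObjCat A) : T.J = IntCat.ι T.star := IntCat.ι_map (bang T) _

lemma J_map {T T' : OneObjCat A} (F : T ⟶ T') : T.J ⋙ IntCat.map F = T'.J := by
  rw [J_eq, J_eq, IntCat.ι_map, obj_star]

end OneObjCat

/-! ### Identity-on-objects functors, Lawvere theories, Lawvere enriched categories -/

/-- A category with the same objects as `A`, together with an identity-on-objects functor from `A`
to it. -/
structure IdOnObj (A : FLCat.{v}) where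
  Hom : A → A → Type v
  id : ∀ a, Hom a a
  comp : ∀ {a b c}, Hom a b → Hom b c → Hom a c
  id_comp : ∀ {a b} (f : Hom a b), comp (id a) f = f
  comp_id : ∀ {a b} (f : Hom a b), comp f (id b) = f
  assoc : ∀ {a b c d} (f : Hom a b) (g : Hom b c) (h : Hom c d),
    comp (comp f g) h = comp f (comp g h)
  map : ∀ {a b : A}, (a ⟶ b) → Hom a b
  map_id : ∀ a, map (𝟙 a) = id a
  map_comp : ∀ {a b c : A} (φ : a ⟶ b) (ψ : b ⟶ c), map (φ ≫ ψ) = comp (map φ) (map ψ)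

namespace IdOnObj

variable {A : FLCat.{v}}

/-- The category under `A`. -/
def Carrier (_ : IdOnObj A) : Type v := A

instance (L : IdOnObj A) : SmallCategory L.Carrier where
  Hom a b := L.Hom a b
  id a := L.id a
  comp f g := L.comp f g
  id_comp f := L.id_comp f
  comp_id f := L.comp_id f
  assoc f g h := L.assoc f g h

/-- The identity-on-objects functor. -/
def J (L : IdOnObj A) : A ⥤ L.Carrier where
  obj a := a
  map φ := L.map φ
  map_id a := L.map_id a
  map_comp φ ψ := L.map_comp φ ψ

/-- Commuting triangles of functors under `A`. -/
@[ext]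
structure Mor (L L' : IdOnObj A) where
  functor : L.Carrier ⥤ L'.Carrier
  comm : L.J ⋙ functor = L'.J

/-- The first factor in the (identity-on-objects, fully faithful) factorisation of a functor
out of `A`. -/
def ofFunctor {C : Type u} [Category.{v} C] (K : A ⥤ C) : IdOnObj A where
  Hom a b := K.obj a ⟶ K.obj b
  id a := 𝟙 (K.obj a)
  comp f g := f ≫ g
  id_comp := Category.id_comp
  comp_id := Category.comp_id
  assoc := Category.assoc
  map φ := K.map φ
  map_id := K.map_id
  map_comp := K.map_comp

/-- The second factor in the (identity-on-objects, fully faithful) factorisation of a functor `K`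
out of `A`. It is an isomorphism of categories if `K` is bijective on objects. -/
def incl {C : Type u} [Category.{v} C] (K : A ⥤ C) : (ofFunctor K).Carrier ⥤ C where
  obj a := K.obj a
  map f := f

/-- `incl K` is fully faithful. -/
def inclFullyFaithful {C : Type u} [Category.{v} C] (K : A ⥤ C) : (incl K).FullyFaithful where
  preimage f := f

/-- Functoriality of `ofFunctor`. -/
def ofFunctorMap {C : Type u} [Category.{v} C] {D : Type u'} [Category.{v} D] {K : A ⥤ C}
    {K' : A ⥤ D} (F : C ⥤ D) (h : K ⋙ F = K') : Mor (ofFunctor K) (ofFunctor K') where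
  functor :=
    { obj := fun a => a
      map := fun {a b} f =>
        (eqToHom (Functor.congr_obj h a).symm ≫ F.map ((incl K).map f) ≫
          eqToHom (Functor.congr_obj h b) : K'.obj a ⟶ K'.obj b)
      map_id := fun a => by
        subst h
        exact (Category.id_comp _).trans ((Category.comp_id _).trans (F.map_id _))
      map_comp := fun {a b c} f g => by
        subst h
        change 𝟙 _ ≫ F.map ((incl K).map f ≫ (incl K).map g) ≫ 𝟙 _ =
          (𝟙 _ ≫ F.map ((incl K).map f) ≫ 𝟙 _) ≫ 𝟙 _ ≫ F.map ((incl K).map g) ≫ 𝟙 _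
        simp }
  comm := by
    subst h
    refine CategoryTheory.Functor.ext (fun _ => rfl) (fun a b φ => ?_)
    change 𝟙 _ ≫ F.map (K.map φ) ≫ 𝟙 _ = 𝟙 _ ≫ F.map (K.map φ) ≫ 𝟙 _
    rfl

lemma eqToHom_comp_ofFunctorMap {C : Type u} [Category.{v} C] {D : Type u'} [Category.{v} D]
    {K : A ⥤ C} {K' : A ⥤ D} (F : C ⥤ D) (h : K ⋙ F = K') {a b : (ofFunctor K).Carrier}
    (f : a ⟶ b) :
    eqToHom (Functor.congr_obj h a) ≫ (incl K').map ((ofFunctorMap F h).functor.map f) =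
      F.map ((incl K).map f) ≫ eqToHom (Functor.congr_obj h b) := by
  subst h
  change 𝟙 _ ≫ 𝟙 _ ≫ F.map ((incl K).map f) ≫ 𝟙 _ = F.map ((incl K).map f) ≫ 𝟙 _
  simp

lemma ofFunctorMap_comp {C : Type u} [Category.{v} C] {D : Type u} [Category.{v} D]
    {E : Type u} [Category.{v} E] {K : A ⥤ C} {K' : A ⥤ D} {K'' : A ⥤ E}
    (F : C ⥤ D) (h : K ⋙ F = K') (G : D ⥤ E) (h' : K' ⋙ G = K'')
    (h'' : K ⋙ F ⋙ G = K'') :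
    (ofFunctorMap (F ⋙ G) h'').functor = (ofFunctorMap F h).functor ⋙ (ofFunctorMap G h').functor := by
  subst h
  subst h'
  refine CategoryTheory.Functor.ext (fun _ => rfl) (fun a b f => ?_)
  change 𝟙 _ ≫ G.map (F.map ((incl K).map f)) ≫ 𝟙 _ =
    𝟙 _ ≫ (𝟙 _ ≫ G.map (𝟙 _ ≫ F.map ((incl K).map f) ≫ 𝟙 _) ≫ 𝟙 _) ≫ 𝟙 _
  simp

end IdOnObj

/-- A Lawvere theory with base `A`, where `A` is thought of as the opposite of the category of
finitely presentable objects of a locally finitely presentable category: a small category `L` with an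
identity-on-objects, finite-limit-preserving functor `J : A ⥤ L`. -/
structure LawvereTheory (A : FLCat.{v}) extends IdOnObj A where
  lex : PreservesFiniteLimits toIdOnObj.J

/-- Morphisms of Lawvere theories are functors commuting with the functors from `A`. -/
instance (A : FLCat.{v}) : Category (LawvereTheory A) where
  Hom L L' := IdOnObj.Mor L.toIdOnObj L'.toIdOnObj
  id L := ⟨𝟭 _, rfl⟩
  comp F G := ⟨F.functor ⋙ G.functor, by rw [← Functor.assoc, F.comm, G.comm]⟩

/-- A Lawvere enriched category with base `A`: a partially finitely complete category `L` with an
identity-on-objects, sieve-reflecting, partially finite-limit-preserving functor `J : A ⥤ L`. -/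
structure LawvereLexProfCat (A : FLCat.{v}) extends IdOnObj A where
  sieve : LeftExactSieve toIdOnObj.Carrier
  partiallyLex : (LeftExactSieve.maximal A).IsPartiallyLex sieve toIdOnObj.J
  reflecting : (LeftExactSieve.maximal A).IsReflecting sieve toIdOnObj.J

namespace LawvereLexProfCat

variable {A : FLCat.{v}}

/-- Morphisms of Lawvere enriched categories: commuting triangles of partially
finite-limit-preserving functors. -/
@[ext]
structure Mor (L L' : LawvereLexProfCat A) extends
    IdOnObj.Mor L.toIdOnObj L'.toIdOnObj where
  isPartiallyLex : L.sieve.IsPartiallyLex L'.sieve functor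

instance (A : FLCat.{v}) : Category (LawvereLexProfCat A) where
  Hom L L' := Mor L L'
  id L := ⟨⟨𝟭 _, rfl⟩, fun h => h⟩
  comp F G := ⟨⟨F.functor ⋙ G.functor, by rw [← Functor.assoc, F.comm, G.comm]⟩,
    fun h => G.isPartiallyLex (F.isPartiallyLex h)⟩

lemma J_mem (L : LawvereLexProfCat A) : L.sieve.mem L.J :=
  L.partiallyLex (X := 𝟭 A) (inferInstanceAs (PreservesFiniteLimits (𝟭 A)))

/-- The Lawvere theory underlying a Lawvere enriched category. -/
def toLawvereTheory (A : FLCat.{v}) : LawvereLexProfCat A ⥤ LawvereTheory A where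
  obj L := ⟨L.toIdOnObj, L.sieve.lex L.J_mem⟩
  map F := F.toMor

end LawvereLexProfCat

namespace OneObjCat

variable {A : FLCat.{v}}

/-- The partially finitely complete category `∫ T`, with its objects `(⋆, i)` renamed to `i`, and the
functor `∫ ! : A ≅ ∫ I_A ⥤ ∫ T`, which is then the identity on objects. -/
def toLawvereObj (T : OneObjCat A) : LawvereLexProfCat A where
  toIdOnObj := IdOnObj.ofFunctor T.J
  sieve :=
    { mem := fun X => (IntCat.sieve T.cat).mem (X ⋙ IdOnObj.incl T.J)
      lex := fun {B X} h => by
        have := (IntCat.sieve T.cat).lex h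
        have := (IdOnObj.inclFullyFaithful T.J).full
        have := (IdOnObj.inclFullyFaithful T.J).faithful
        exact preservesFiniteLimits_of_reflects_of_preserves X (IdOnObj.incl T.J)
      precomp := fun G hG h => (IntCat.sieve T.cat).precomp G hG h
      iso := fun e h => (IntCat.sieve T.cat).iso (Functor.isoWhiskerRight e _) h
      cover := fun a => ⟨A, (IdOnObj.ofFunctor T.J).J,
        ⟨A, T.star, 𝟭 _, inferInstance, ⟨eqToIso T.J_eq⟩⟩, a, rfl⟩ }
  partiallyLex {B G} hG :=
    ⟨A, T.star, G, hG, ⟨Functor.isoWhiskerLeft G (eqToIso T.J_eq)⟩⟩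
  reflecting {B Y} h := by
    obtain ⟨B', Z, F, hF, ⟨e⟩⟩ := h
    obtain ⟨rfl, h⟩ := Sigma.mk.inj (T.eq_star Z)
    obtain rfl := eq_of_heq h
    exact ⟨F, hF, ⟨(IdOnObj.inclFullyFaithful T.J).whiskeringRight B |>.preimageIso
      (Functor.isoWhiskerLeft F (eqToIso T.J_eq) ≪≫ e.symm)⟩⟩

/-- Free completion under absolute tensors as a functor from one-object enriched categories of extent
`A` to Lawvere enriched categories with base `A`. -/
def toLawvere (A : FLCat.{v}) : OneObjCat A ⥤ LawvereLexProfCat A where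
  obj T := T.toLawvereObj
  map {T T'} F :=
    { toMor := IdOnObj.ofFunctorMap (IntCat.map F) (J_map F)
      isPartiallyLex := fun {B X} h => by
        have e : IdOnObj.incl T.J ⋙ IntCat.map F ≅
            (IdOnObj.ofFunctorMap (IntCat.map F) (J_map F)).functor ⋙ IdOnObj.incl T'.J :=
          NatIso.ofComponents (fun a => eqToIso (Functor.congr_obj (J_map F) a)) (by
            intro a b f
            exact (IdOnObj.eqToHom_comp_ofFunctorMap (IntCat.map F) (J_map F) f).symm)
        exact (IntCat.sieve T'.cat).iso (Functor.isoWhiskerLeft X e)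
          (IntCat.map_isPartiallyLex F h) }
  map_id T := by
    refine LawvereLexProfCat.Mor.ext ?_
    refine CategoryTheory.Functor.ext (fun _ => rfl) (fun a b f => ?_)
    exact (Category.id_comp _).trans ((Category.comp_id _).trans
      ((Category.id_comp _).trans (Category.comp_id f)).symm)
  map_comp F G := by
    refine LawvereLexProfCat.Mor.ext ?_
    exact IdOnObj.ofFunctorMap_comp (IntCat.map F) (J_map F) (IntCat.map G) (J_map G)
      (J_map (F ≫ G))

end OneObjCat

/-! ### Models of Lawvere theories -/

namespace LawvereTheory

variable {A : FLCat.{v}}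

/-- The category of models of a Lawvere theory `J : A ⥤ L`: functors `L ⥤ Set` whose restriction
along `J` preserves finite limits, and all natural transformations. -/
abbrev Model (L : LawvereTheory A) :=
  ObjectProperty.FullSubcategory
    (fun F : L.Carrier ⥤ Type v => PreservesFiniteLimits (L.J ⋙ F))

/-- The functor between categories of models induced by a morphism of Lawvere theories. -/
def modelMap {L L' : LawvereTheory A} (F : L ⟶ L') : L'.Model ⥤ L.Model where
  obj M := ⟨IdOnObj.Mor.functor F ⋙ M.obj, by
    have h : PreservesFiniteLimits (L'.J ⋙ M.obj) := M.property
    change PreservesFiniteLimits ((L.J ⋙ IdOnObj.Mor.functor F) ⋙ M.obj)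
    rw [IdOnObj.Mor.comm]
    exact h⟩
  map α := ObjectProperty.homMk (Functor.whiskerLeft (IdOnObj.Mor.functor F) α.hom)

/-- The functor sending a Lawvere theory to its category of models. -/
def mod (A : FLCat.{v}) : (LawvereTheory A)ᵒᵖ ⥤ Cat.{v, v + 1} where
  obj L := Cat.of L.unop.Model
  map F := (modelMap F.unop).toCatHom
  map_id _ := rfl
  map_comp _ _ := rfl

end LawvereTheory

/-! ### Finitary monads and their algebras -/

section Monads

variable (A : Type (v + 1)) [LargeCategory.{v} A]

/-- The category of finitary monads: monads whose underlying endofunctor preserves filtered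
colimits. -/
abbrev FinitaryMonad :=
  ObjectProperty.FullSubcategory (fun T : Monad A => PreservesFilteredColimits (T : A ⥤ A))

variable {A} in
lemma algebra_functor_ext {S T : Monad A} (F G : T.Algebra ⥤ S.Algebra)
    (hA : ∀ X, (F.obj X).A = (G.obj X).A) (ha : ∀ X, HEq (F.obj X).a (G.obj X).a)
    (hf : ∀ {X Y : T.Algebra} (f : X ⟶ Y), HEq (F.map f).f (G.map f).f) : F = G := by
  have hobj : ∀ X Y : S.Algebra, X.A = Y.A → HEq X.a Y.a → X = Y := by
    rintro ⟨X, a, _, _⟩ ⟨Y, b, _, _⟩ h h'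
    obtain rfl : X = Y := h
    obtain rfl := eq_of_heq h'
    rfl
  have hhom : ∀ {X X' Y Y' : S.Algebra} (f : X ⟶ Y) (g : X' ⟶ Y'), X = X' → Y = Y' →
      HEq f.f g.f → HEq f g := by
    rintro X X' Y Y' f g rfl rfl h
    exact heq_of_eq (Monad.Algebra.Hom.ext (eq_of_heq h))
  exact CategoryTheory.Functor.hext (fun X => hobj _ _ (hA X) (ha X))
    (fun X Y f => hhom _ _ (hobj _ _ (hA X) (ha X)) (hobj _ _ (hA Y) (ha Y)) (hf f))

/-- The functor sending a finitary monad to its category of Eilenberg--Moore algebras. -/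
def alg : (FinitaryMonad A)ᵒᵖ ⥤ Cat.{v, v + 1} where
  obj T := Cat.of T.unop.obj.Algebra
  map θ := (Monad.algebraFunctorOfMonadHom θ.unop.hom).toCatHom
  map_id _ := Cat.ext (algebra_functor_ext _ _ (fun _ => rfl)
    (fun X => heq_of_eq (Category.id_comp X.a)) (fun _ => HEq.rfl))
  map_comp _ _ := Cat.ext (algebra_functor_ext _ _ (fun _ => rfl)
    (fun X => heq_of_eq (Category.assoc _ _ X.a)) (fun _ => HEq.rfl))

/-- A small category equivalent to the full subcategory of finitely presentable objects of `A`,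
with its embedding into `A`. -/
structure FPModel where
  carrier : Type v
  [cat : SmallCategory carrier]
  ι : carrier ⥤ A
  [full : ι.Full]
  [faithful : ι.Faithful]
  essImage_iff : ∀ X : A, ι.essImage X ↔ IsFinitelyPresentable.{v} X

end Monads

namespace FPModel

attribute [instance] FPModel.cat FPModel.full FPModel.faithful

variable {A : Type (v + 1)} [LargeCategory.{v} A] (M : FPModel A)

/-- The embedding, with values in the full subcategory of finitely presentable objects. -/
def toFullSubcategory :
    M.carrier ⥤ (ObjectProperty.isFinitelyPresentable.{v} A).FullSubcategory :=
  ObjectProperty.lift (ObjectProperty.isFinitelyPresentable.{v} A) M.ι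
    (fun X => (M.essImage_iff _).1 (M.ι.obj_mem_essImage X))

lemma toFullSubcategory_isEquivalence : M.toFullSubcategory.IsEquivalence where
  full := ⟨fun f => ⟨M.ι.preimage f.hom, by
    ext
    exact M.ι.map_preimage _⟩⟩
  faithful := ⟨fun {X Y f g} h => M.ι.map_injective (congrArg (fun t => t.hom) h)⟩
  essSurj := ⟨fun Y => by
    obtain ⟨X, ⟨e⟩⟩ := (M.essImage_iff _).2 Y.property
    exact ⟨X, ⟨ObjectProperty.isoMk _ e⟩⟩⟩

/-- A small model of the finitely presentable objects is equivalent to the full subcategory they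
span. -/
noncomputable def equiv :
    M.carrier ≌ (ObjectProperty.isFinitelyPresentable.{v} A).FullSubcategory :=
  have := M.toFullSubcategory_isEquivalence
  M.toFullSubcategory.asEquivalence

lemma closed (J : Type) [SmallCategory J] [FinCategory J] :
    (ObjectProperty.isFinitelyPresentable.{v} A).IsClosedUnderColimitsOfShape J := by
  have := Cardinal.fact_isRegular_aleph0
  rw [ObjectProperty.isFinitelyPresentable_eq_isCardinalPresentable]
  apply isClosedUnderColimitsOfShape_isCardinalPresentable
  rw [hasCardinalLT_aleph0_iff]
  infer_instance

variable [IsLocallyFinitelyPresentable.{v} A]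

instance : HasFiniteColimits M.carrier where
  out J _ _ := by
    have := closed (A := A) J
    exact Adjunction.hasColimitsOfShape_of_equivalence M.equiv.functor

instance : PreservesFiniteColimits M.ι where
  preservesFiniteColimits J _ _ := by
    have := closed (A := A) J
    have : PreservesColimitsOfShape J (M.equiv.functor ⋙ ObjectProperty.ι _) := inferInstance
    exact preservesColimitsOfShape_of_natIso (F := M.equiv.functor ⋙ ObjectProperty.ι _)
      (Iso.refl _)

/-- The opposite of the category of finitely presentable objects. -/
abbrev base : FLCat.{v} where
  carrier := M.carrierᵒᵖ

/-- The lex profunctor `(i, j) ↦ A(j, T i)` on the opposite of the category of finitely presentable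
objects, for an endofunctor `T`. -/
def lexProf (T : A ⥤ A) : LexProf M.base M.base where
  obj i := ⟨M.ι.op ⋙ yoneda.obj (T.obj (M.ι.obj i.unop.unop)), by
    have : PreservesFiniteLimits M.ι.op := preservesFiniteLimits_op _
    exact inferInstanceAs (PreservesFiniteLimits (M.ι.op ⋙ yoneda.obj _))⟩
  map φ := ObjectProperty.homMk
    (Functor.whiskerLeft M.ι.op (yoneda.map (T.map (M.ι.map φ.unop.unop))))
  map_id i := by
    ext j (x : M.ι.obj j.unop ⟶ T.obj (M.ι.obj i.unop.unop))
    change x ≫ T.map (M.ι.map (𝟙 i.unop.unop)) = x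
    rw [M.ι.map_id, T.map_id, Category.comp_id]
  map_comp {i i' i''} φ ψ := by
    ext j (x : M.ι.obj j.unop ⟶ T.obj (M.ι.obj i.unop.unop))
    change x ≫ T.map (M.ι.map (φ.unop.unop ≫ ψ.unop.unop)) =
      (x ≫ T.map (M.ι.map φ.unop.unop)) ≫ T.map (M.ι.map ψ.unop.unop)
    rw [M.ι.map_comp, T.map_comp, Category.assoc]

section Kleisli

variable {A : Type (v + 1)} [LargeCategory.{v} A] (T : Monad A)

lemma kl_lmap {X Y Z W : A} (f : X ⟶ T.obj Y) (g : Z ⟶ T.obj X) (a : Y ⟶ W) :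
    g ≫ T.map (f ≫ T.map a) ≫ T.μ.app W = (g ≫ T.map f ≫ T.μ.app Y) ≫ T.map a := by
  have := T.μ.naturality a
  dsimp at this
  simp [this]

lemma kl_dinatural {X X' Y Z : A} (f : X ⟶ T.obj Y) (a : X' ⟶ X) (g : Z ⟶ T.obj X') :
    g ≫ T.map (a ≫ f) ≫ T.μ.app Y = (g ≫ T.map a) ≫ T.map f ≫ T.μ.app Y := by
  simp

lemma kl_unit {X Y Z : A} (a : X ⟶ Y) (b : Y ⟶ Z) :
    (a ≫ b) ≫ T.η.app Z = (a ≫ T.η.app Y) ≫ T.map b := by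
  have := T.η.naturality b
  dsimp at this
  simp [this]

lemma kl_one_mul {X Y : A} (a : Y ⟶ Y) (h : a = 𝟙 Y) (f : X ⟶ T.obj Y) :
    f ≫ T.map (a ≫ T.η.app Y) ≫ T.μ.app Y = f := by
  subst h
  simp

lemma kl_mul_one {X Y : A} (a : X ⟶ X) (h : a = 𝟙 X) (f : X ⟶ T.obj Y) :
    (a ≫ T.η.app X) ≫ T.map f ≫ T.μ.app Y = f := by
  subst h
  have := T.η.naturality f
  dsimp at this
  rw [Category.id_comp, ← reassoc_of% this, T.left_unit]
  exact Category.comp_id f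

lemma kl_assoc {X Y Z W : A} (f : Y ⟶ T.obj X) (g : Z ⟶ T.obj Y) (h : W ⟶ T.obj Z) :
    h ≫ T.map (g ≫ T.map f ≫ T.μ.app X) ≫ T.μ.app X =
      (h ≫ T.map g ≫ T.μ.app Y) ≫ T.map f ≫ T.μ.app X := by
  have := T.μ.naturality f
  dsimp at this
  simp only [Functor.map_comp, Category.assoc, T.assoc, reassoc_of% this]

variable {T} in
lemma kl_hom_lmap {S : Monad A} (θ : S ⟶ T) {X Y Z : A} (a : X ⟶ Y) (f : Z ⟶ S.obj X) :
    (f ≫ S.map a) ≫ θ.app Y = (f ≫ θ.app X) ≫ T.map a := by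
  have h : S.map a ≫ θ.app Y = θ.app X ≫ T.map a := θ.naturality a
  rw [Category.assoc, Category.assoc, h]

variable {T} in
lemma kl_hom_unit {S : Monad A} (θ : S ⟶ T) {X Y : A} (a : X ⟶ Y) :
    (a ≫ S.η.app Y) ≫ θ.app Y = a ≫ T.η.app Y := by
  simp

variable {T} in
lemma kl_map {S : Monad A} (θ : S ⟶ T) {X Y Z : A} (f : Y ⟶ S.obj X) (g : Z ⟶ S.obj Y) :
    (g ≫ S.map f ≫ S.μ.app X) ≫ θ.app X =
      (g ≫ θ.app Y) ≫ T.map (f ≫ θ.app X) ≫ T.μ.app X := by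
  have h : S.map (f ≫ θ.app X) ≫ θ.app (T.obj X) = θ.app Y ≫ T.map (f ≫ θ.app X) :=
    θ.naturality _
  simp only [Category.assoc, θ.app_μ, ← reassoc_of% h]
  simp

end Kleisli

/-- The one-object enriched category of a monad `T`: its hom is the lex profunctor
`(i, j) ↦ A(j, T i)`, with Kleisli composition and with identities induced by the unit
of `T`. -/
def toOneObjObj (T : Monad A) : OneObjCat M.base :=
  OneObjCat.ofMonad (M.lexProf (T : A ⥤ A))
    { fn := fun {i j k}
          (f : M.ι.obj j.unop ⟶ (T : A ⥤ A).obj (M.ι.obj i.unop))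
          (g : M.ι.obj k.unop ⟶ (T : A ⥤ A).obj (M.ι.obj j.unop)) =>
        (g ≫ (T : A ⥤ A).map f ≫ T.μ.app _ : M.ι.obj k.unop ⟶ _)
      fn_lmap := fun φ f g => kl_lmap T f g (M.ι.map φ.unop)
      fn_rmap := fun _ _ _ => Category.assoc _ _ _
      dinatural := fun ψ f g => kl_dinatural T f (M.ι.map ψ.unop) g }
    (homMk (fun {i j} (φ : i ⟶ j) => (M.ι.map φ.unop ≫ T.η.app _ : M.ι.obj j.unop ⟶ _))
      (fun φ _ ψ => (congrArg (· ≫ T.η.app _) (M.ι.map_comp _ _)).trans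
        (kl_unit T (M.ι.map (Quiver.Hom.unop ψ)) (M.ι.map φ.unop)))
      (fun _ _ => (congrArg (· ≫ T.η.app _) (M.ι.map_comp _ _)).trans
        (Category.assoc _ _ _)))
    (fun f => kl_one_mul T _ (M.ι.map_id _) f)
    (fun f => kl_mul_one T _ (M.ι.map_id _) f)
    (fun f g h => kl_assoc T f g h)

/-- The passage from finitary monads on `A` to one-object enriched categories of extent the opposite
of the category of finitely presentable objects. -/
def toOneObj : FinitaryMonad A ⥤ OneObjCat M.base where
  obj T := M.toOneObjObj T.obj
  map {S T} θ := OneObjCat.ofMonadMap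
    (homMk (fun {i j} (f : M.ι.obj j.unop ⟶ S.obj.obj (M.ι.obj i.unop)) =>
        (f ≫ θ.hom.app _ : M.ι.obj j.unop ⟶ T.obj.obj (M.ι.obj i.unop)))
      (fun φ _ f => kl_hom_lmap θ.hom (M.ι.map φ.unop) f)
      (fun _ _ => Category.assoc _ _ _))
    (hom_ext fun _ _ φ => kl_hom_unit θ.hom (M.ι.map (Quiver.Hom.unop φ)))
    (fun f g => kl_map θ.hom f g)
  map_id _ := OneObjCat.ofMonadMap_eq_id _ _ _ (hom_ext fun _ _ _ => Category.comp_id _)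
  map_comp _ _ := OneObjCat.ofMonadMap_eq_comp _ _ _ _ _ _ _ _ _
    (hom_ext fun _ _ _ => (Category.assoc _ _ _).symm)

/-- The composite passage from finitary monads on `A` to Lawvere theories with base the opposite of the
category of finitely presentable objects: take the one-object enriched category of the monad, freely
complete it under absolute tensors, and take the Lawvere theory underlying the resulting Lawvere
enriched category. -/
def monadToTheory : FinitaryMonad A ⥤ LawvereTheory M.base :=
  M.toOneObj ⋙ OneObjCat.toLawvere M.base ⋙ LawvereLexProfCat.toLawvereTheory M.base

end FPModel

end LexEnriched

open LexEnriched

namespace LexEnriched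

open LexProf

/-! ### Tensors and right liftings -/

namespace LexProf

variable {A B C : FLCat.{v}}

/-- The functor `j ↦ M(-, j)` of a lex profunctor `M`. -/
abbrev col (M : LexProf A B) : B ⥤ Aᵒᵖ ⥤ Type v :=
  (M ⋙ ObjectProperty.ι _).flip

instance (M : LexProf A B) : PreservesFiniteLimits (col M) :=
  preservesFiniteLimits_of_evaluation _ fun i =>
    inferInstanceAs (PreservesFiniteLimits (M.obj i).obj)

/-- The right lifting of `P` through `W`, with elements the transformations `W(-, j) ⟶ P(-, k)`. -/
def lifting (W : LexProf A B) (P : LexProf A C) : LexProf B C where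
  obj j := ⟨col P ⋙ coyoneda.obj (op ((col W).obj j.unop)), by
    simp only [leftExactFunctor_iff]; infer_instance⟩
  map φ := ObjectProperty.homMk
    (Functor.whiskerLeft (col P) (coyoneda.map ((col W).map φ.unop).op))

/-- `2`-cells `U ⊗ W ⟶ P` are the same as maps from `U` to the lifting of `P` through `W`. -/
def curry {W : LexProf A B} {U : LexProf B C} {P : LexProf A C} (b : Bimor W U P) :
    U ⟶ lifting W P :=
  homMk
    (fun {j k} x =>
      ({ app := fun _ => TypeCat.ofHom (fun w => b.fn w x)
         naturality := fun i i' φ => by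
          ext w
          exact b.fn_lmap φ.unop w x } : (col W).obj j ⟶ (col P).obj k))
    (fun {j' j} ψ {k} x => by
      refine NatTrans.ext (funext fun i => ?_)
      ext w
      exact (b.dinatural ψ w x).symm)
    (fun χ x => by
      refine NatTrans.ext (funext fun i => ?_)
      ext w
      exact b.fn_rmap χ w x)

/-- The inverse of `curry`. -/
def uncurry {W : LexProf A B} {U : LexProf B C} {P : LexProf A C} (f : U ⟶ lifting W P) :
    Bimor W U P where
  fn {i j k} w x := (show (col W).obj j ⟶ (col P).obj k from ap f x).app (op i) w
  fn_lmap {i' i j k} φ w x :=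
    ((show (col W).obj j ⟶ (col P).obj k from ap f x).naturality_apply φ.op w)
  fn_rmap {i j k k'} χ w x := by
    rw [ap_rmap]
    rfl
  dinatural {i j j' k} ψ w x := by
    rw [ap_lmap]
    rfl

lemma curry_bijective {W : LexProf A B} {U : LexProf B C} {P : LexProf A C} :
    Function.Bijective (curry : Bimor W U P → (U ⟶ lifting W P)) :=
  Function.bijective_iff_has_inverse.2 ⟨uncurry, fun _ => rfl, fun _ => rfl⟩

lemma isIso_iff {M N : LexProf A B} (f : M ⟶ N) :
    IsIso f ↔ ∀ (i : A) (j : B), Function.Bijective (ap f : M.El i j → N.El i j) := by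
  rw [NatTrans.isIso_iff_isIso_app]
  constructor
  · intro h i j
    have := h (op i)
    have : IsIso (f.app (op i)).hom :=
      inferInstanceAs (IsIso ((ObjectProperty.ι _).map (f.app (op i))))
    exact (isIso_iff_bijective _).1 (inferInstanceAs (IsIso ((f.app (op i)).hom.app j)))
  · intro h i
    have : IsIso ((ObjectProperty.ι _).map (f.app i)) := by
      have : ∀ j, IsIso ((f.app i).hom.app j) :=
        fun j => (isIso_iff_bijective _).2 (h i.unop j)
      exact NatIso.isIso_of_isIso_app (f.app i).hom
    exact isIso_of_fully_faithful (ObjectProperty.ι _) (f.app i)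

end LexProf

namespace LexProfCat

variable (C : LexProfCat.{v})

/-- The comparison `C(Y, Z) ⟶ [W, C(X, Z)]` of a map `u : W ⟶ C(X, Y)`. -/
def tensorComparison {A B E : FLCat.{v}} {W : LexProf A B} {X : C.Obj A} {Y : C.Obj B}
    (u : W ⟶ C.hom X Y) (Z : C.Obj E) : C.hom Y Z ⟶ lifting W (C.hom X Z) :=
  curry ((C.comp X Y Z).precomp u (𝟙 _))

lemma isTensor_iff_bijective {A B : FLCat.{v}} {W : LexProf A B} {X : C.Obj A} {Y : C.Obj B}
    (u : W ⟶ C.hom X Y) :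
    C.IsTensor W X Y u ↔ ∀ {E : FLCat.{v}} (Z : C.Obj E) (j : B) (k : E),
      Function.Bijective (ap (C.tensorComparison u Z) :
        (C.hom Y Z).El j k → (lifting W (C.hom X Z)).El j k) := by
  have key : ∀ {E : FLCat.{v}} (U : LexProf B E) (Z : C.Obj E),
      Function.Bijective
        (fun f : U ⟶ C.hom Y Z => ((C.comp X Y Z).precomp u f : Bimor W U (C.hom X Z))) ↔
      Function.Bijective (fun f : U ⟶ C.hom Y Z => f ≫ C.tensorComparison u Z) := by
    intro E U Z
    exact (Function.Bijective.of_comp_iff' curry_bijective _).symm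
  constructor
  · intro h E Z
    rw [← LexProf.isIso_iff, isIso_iff_yoneda_map_bijective]
    exact fun U => (key U Z).1 (h U Z)
  · intro h E U Z
    rw [key]
    have := (LexProf.isIso_iff _).2 (h Z)
    exact (isIso_iff_yoneda_map_bijective _).1 this U

end LexProfCat

/-! ### Representable lex profunctors -/

namespace LexProf

variable {A B : FLCat.{v}}

/-- The lex profunctor `(i, j) ↦ A(i, F j)`. -/
def rep (F : B ⥤ A) [PreservesFiniteLimits F] : LexProf A B where
  obj i := ⟨F ⋙ coyoneda.obj i, by
    simp only [leftExactFunctor_iff]; infer_instance⟩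
  map φ := ObjectProperty.homMk (Functor.whiskerLeft F (coyoneda.map φ))

/-- The generic elements of a representable lex profunctor. -/
def gen {F : B ⥤ A} [PreservesFiniteLimits F] {W : LexProf A B} (e : rep F ⟶ W) (j : B) :
    W.El (F.obj j) j :=
  ap e (show (rep F).El (F.obj j) j from 𝟙 (F.obj j))

lemma lmap_gen {F : B ⥤ A} [PreservesFiniteLimits F] {W : LexProf A B} (e : rep F ⟶ W)
    {i : A} {j : B} (φ : i ⟶ F.obj j) :
    W.lmap φ (gen e j) = ap e (show (rep F).El i j from φ) :=
  (ap_lmap e φ _).symm.trans (congrArg (fun t => ap e (show (rep F).El i j from t))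
    (Category.comp_id φ))

lemma rmap_gen {F : B ⥤ A} [PreservesFiniteLimits F] {W : LexProf A B} (e : rep F ⟶ W)
    {j j' : B} (ψ : j ⟶ j') :
    W.rmap ψ (gen e j) = W.lmap (F.map ψ) (gen e j') := by
  rw [lmap_gen]
  exact (ap_rmap e ψ _).symm.trans (congrArg (fun t => ap e (show (rep F).El _ j' from t))
    (Category.id_comp (F.map ψ)))

/-- Maps out of a representable lex profunctor. -/
lemma lifting_eval_bijective {F : B ⥤ A} [PreservesFiniteLimits F] {W : LexProf A B}
    (e : rep F ≅ W) {E : FLCat.{v}} (P : LexProf A E) (j : B) (k : E) :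
    Function.Bijective (fun f : (col W).obj j ⟶ (col P).obj k =>
      (show P.El (F.obj j) k from f.app (op (F.obj j)) (gen e.hom j))) := by
  have he : ∀ {i : A} (w : W.El i j), ∃ φ : i ⟶ F.obj j, w = W.lmap φ (gen e.hom j) := by
    intro i w
    refine ⟨(show i ⟶ F.obj j from ap e.inv w), ?_⟩
    exact (congrArg (fun t => ap t w) e.inv_hom_id).symm.trans (lmap_gen e.hom _).symm
  have he' : ∀ {i : A} (φ ψ : i ⟶ F.obj j),
      W.lmap φ (gen e.hom j) = W.lmap ψ (gen e.hom j) → φ = ψ := by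
    intro i φ ψ h
    rw [lmap_gen, lmap_gen] at h
    have h' := congrArg (ap e.inv) h
    rw [← ap_comp, ← ap_comp, e.hom_inv_id] at h'
    exact h'
  constructor
  · intro f g h
    refine NatTrans.ext (funext fun i => ?_)
    ext w
    obtain ⟨φ, rfl⟩ := he w
    exact (f.naturality_apply φ.op _).trans
      ((congrArg (P.lmap φ) h).trans (g.naturality_apply φ.op _).symm)
  · intro x
    choose t ht using @he
    refine ⟨{ app := fun i => TypeCat.ofHom (fun w => P.lmap (t (i := i.unop) w) x)
              naturality := fun i i' φ => ?_ }, ?_⟩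
    · ext w
      change P.lmap (t (W.lmap φ.unop w)) x = P.lmap φ.unop (P.lmap (t w) x)
      rw [← lmap_comp]
      congr 1
      apply he'
      rw [← ht, lmap_comp, ← ht]
    · change P.lmap (t (gen e.hom j)) x = x
      have : t (gen e.hom j) = 𝟙 _ := by
        apply he'
        rw [← ht, lmap_id]
      rw [this, lmap_id]

end LexProf

namespace LexProfCat

variable (C : LexProfCat.{v}) {A B : FLCat.{v}} {F : B ⥤ A} [PreservesFiniteLimits F]
  {W : LexProf A B} {X : C.Obj A} {Y : C.Obj B}

/-- The morphisms `(X, F j) ⟶ (Y, j)` of `∫ C` classified by a map from a representable lex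
profunctor. -/
def genHom (e : rep F ⟶ W) (u : W ⟶ C.hom X Y) (j : B) :
    (⟨A, X, F.obj j⟩ : IntCat C) ⟶ ⟨B, Y, j⟩ :=
  ap u (gen e j)

lemma isTensor_iff_isIso (e : rep F ≅ W) (u : W ⟶ C.hom X Y) :
    C.IsTensor W X Y u ↔ ∀ j, IsIso (C.genHom e.hom u j) := by
  rw [isTensor_iff_bijective]
  have : ∀ {E : FLCat.{v}} (Z : C.Obj E) (j : B) (k : E),
      Function.Bijective (ap (C.tensorComparison u Z) :
        (C.hom Y Z).El j k → (lifting W (C.hom X Z)).El j k) ↔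
      Function.Bijective (fun f : (⟨B, Y, j⟩ : IntCat C) ⟶ ⟨E, Z, k⟩ =>
        C.genHom e.hom u j ≫ f) := fun Z j k =>
    (Function.Bijective.of_comp_iff' (lifting_eval_bijective e (C.hom X Z) j k) _).symm
  simp only [this]
  constructor
  · intro h j
    rw [isIso_iff_coyoneda_map_bijective]
    exact fun p => h p.obj j p.pt
  · intro h E Z j k
    exact (isIso_iff_coyoneda_map_bijective _).1 (h j) _

lemma genHom_naturality (e : rep F ⟶ W) (u : W ⟶ C.hom X Y) {j j' : B} (ψ : j ⟶ j') :
    (F ⋙ IntCat.ι X).map ψ ≫ C.genHom e u j' = C.genHom e u j ≫ (IntCat.ι Y).map ψ :=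
  (C.idMap_comp X Y (F.map ψ) _).trans (((ap_lmap u _ _).symm.trans
    ((congrArg (ap u) (rmap_gen e ψ).symm).trans (ap_rmap u _ _))).trans
      (C.comp_idMap X Y _ ψ).symm)

lemma IsTensor.exists_iso (e : rep F ≅ W) {u : W ⟶ C.hom X Y} (h : C.IsTensor W X Y u) :
    Nonempty (F ⋙ IntCat.ι X ≅ IntCat.ι Y) := by
  rw [isTensor_iff_isIso C e] at h
  exact ⟨NatIso.ofComponents (fun j => @asIso _ _ _ _ (C.genHom e.hom u j) (h j))
    (fun ψ => C.genHom_naturality e.hom u ψ)⟩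

end LexProfCat

lemma LexProf.isAbsolute_of_iso {A B : FLCat.{v}} {F : B ⥤ A} [PreservesFiniteLimits F]
    {W : LexProf A B} (e : rep F ≅ W) : W.IsAbsolute := by
  intro C D G X Y u h
  rw [LexProfCat.isTensor_iff_isIso _ e] at h ⊢
  intro j
  have := h j
  exact inferInstanceAs (IsIso ((IntCat.map G).map (C.genHom e.hom u j)))

/-! ### The sieve of all finite-limit-preserving functors -/

/-- Shapes of limits that generate all finite limits: parallel pairs and finite discrete
categories. -/
def GeneratingShape : Option ℕ → Type
  | none => WalkingParallelPair
  | some n => Discrete (Fin n)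

instance : ∀ a, SmallCategory (GeneratingShape a)
  | none => inferInstanceAs (SmallCategory WalkingParallelPair)
  | some n => inferInstanceAs (SmallCategory (Discrete (Fin n)))

instance (a : Option ℕ) : Small.{v} (GeneratingShape a) := small_lift _

section

variable {E : Type u} [Category.{v} E] (c : E)

/-- The closure of an object under finite limits. -/
abbrev finiteLimitsClosure : ObjectProperty E :=
  (ObjectProperty.singleton c).limitsClosure GeneratingShape

instance : (finiteLimitsClosure c).IsClosedUnderLimitsOfShape WalkingParallelPair :=
  inferInstanceAs (ObjectProperty.IsClosedUnderLimitsOfShape _ (GeneratingShape none))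

instance (n : ℕ) : (finiteLimitsClosure c).IsClosedUnderLimitsOfShape (Discrete (Fin n)) :=
  inferInstanceAs (ObjectProperty.IsClosedUnderLimitsOfShape _ (GeneratingShape (some n)))

/-- Every object of a locally small category with finite limits is in the image of a
finite-limit-preserving functor with small domain. -/
lemma exists_lex_functor [HasFiniteLimits E] :
    ∃ (A : FLCat.{v}) (X : A ⥤ E), PreservesFiniteLimits X ∧ ∃ a : A, X.obj a = c := by
  classical
  let P := finiteLimitsClosure c
  have : HasFiniteProducts P.FullSubcategory := ⟨fun n => inferInstance⟩
  have : HasEqualizers P.FullSubcategory := inferInstance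
  have : HasFiniteLimits P.FullSubcategory := hasFiniteLimits_of_hasEqualizers_and_finite_products
  have : PreservesFiniteProducts P.ι := ⟨fun n => inferInstance⟩
  have : PreservesFiniteLimits P.ι :=
    preservesFiniteLimits_of_preservesEqualizers_and_finiteProducts _
  let S := SmallModel.{v} P.FullSubcategory
  have : HasFiniteLimits S := ⟨fun J _ _ =>
    Adjunction.hasLimitsOfShape_of_equivalence (equivSmallModel.{v} P.FullSubcategory).inverse⟩
  let X : S ⥤ E := (equivSmallModel.{v} P.FullSubcategory).inverse ⋙ P.ι
  let p : P.FullSubcategory := ⟨c, ObjectProperty.le_limitsClosure _ _ _ (by simp)⟩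
  let a : S := (equivSmallModel.{v} P.FullSubcategory).functor.obj p
  let i : X.obj a ≅ c :=
    P.ι.mapIso ((equivSmallModel.{v} P.FullSubcategory).unitIso.symm.app p)
  let o : S → E := fun s => if s = a then c else X.obj s
  let e : ∀ s, X.obj s ≅ o s := fun s =>
    if h : s = a then eqToIso (congrArg X.obj h) ≪≫ i ≪≫ eqToIso (if_pos h).symm
    else eqToIso (if_neg h).symm
  refine ⟨⟨S⟩, X.copyObj o e, preservesFiniteLimits_of_natIso (X.isoCopyObj o e), a, if_pos rfl⟩

end

/-- The sieve of all finite-limit-preserving functors with small domain. -/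
def LeftExactSieve.all (E : Type u) [Category.{v} E] [HasFiniteLimits E] : LeftExactSieve E where
  mem X := PreservesFiniteLimits X
  lex h := h
  precomp _ _ _ := inferInstance
  iso e h := by
    have := h
    exact preservesFiniteLimits_of_natIso e
  cover c := exists_lex_functor c

/-- The enriched functor `Γ(C) ⟶ Γ(D)` induced by a partially finite-limit-preserving functor. -/
def Γmap {C D : Type (v + 1)} [Category.{v} C] [Category.{v} D] {S : LeftExactSieve C}
    {S' : LeftExactSieve D} (F : C ⥤ D) (hF : S.IsPartiallyLex S' F) :
    LexProfFunctor (Γ S) (Γ S') where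
  obj X := ⟨X.1 ⋙ F, hF X.2⟩
  map X Y := homMk (fun {i j} (f : X.1.obj i ⟶ Y.1.obj j) => F.map f)
    (fun _ _ _ => F.map_comp _ _) (fun _ _ => F.map_comp _ _)
  map_ident _ := rfl
  map_comp _ _ _ _ _ _ _ _ := F.map_comp _ _

/-! ### Absolute tensors -/

namespace LexProf

variable {A B : FLCat.{v}} (W : LexProf A B)

/-- The Yoneda embedding, as an object of the enriched category of presheaves. -/
def yonedaObj (A : FLCat.{v}) : (Γ (LeftExactSieve.all (Aᵒᵖ ⥤ Type v))).Obj A :=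
  ⟨yoneda, inferInstanceAs (PreservesFiniteLimits yoneda)⟩

/-- A lex profunctor, as an object of the enriched category of presheaves. -/
def presheafObj : (Γ (LeftExactSieve.all (Aᵒᵖ ⥤ Type v))).Obj B :=
  ⟨col W, inferInstanceAs (PreservesFiniteLimits (col W))⟩

/-- The Yoneda lemma. -/
def yonedaUnit :
    W ⟶ (Γ (LeftExactSieve.all (Aᵒᵖ ⥤ Type v))).hom (yonedaObj A) (presheafObj W) :=
  homMk (fun {i j} w => (yonedaEquiv.symm w : yoneda.obj i ⟶ (col W).obj j))
    (fun {_ _} φ {j} x => yonedaEquiv_symm_map φ.op (F := (col W).obj j) x)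
    (fun {i _ _} ψ x => (yonedaEquiv_symm_naturality_right i ((col W).map ψ) x).symm)

lemma yonedaUnit_isTensor :
    (Γ (LeftExactSieve.all (Aᵒᵖ ⥤ Type v))).IsTensor W (yonedaObj A) (presheafObj W)
      (yonedaUnit W) := by
  rw [LexProfCat.isTensor_iff_bijective]
  intro E Z j k
  constructor
  · intro f g h
    refine NatTrans.ext (funext fun i => ?_)
    ext (w : W.El i.unop j)
    have h' := congrArg (fun t : (col W).obj j ⟶
      (col ((Γ (LeftExactSieve.all (Aᵒᵖ ⥤ Type v))).hom (yonedaObj A) Z)).obj k => t.app i w) h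
    have := congrArg (fun t : yoneda.obj i.unop ⟶ Z.1.obj k => yonedaEquiv t) h'
    change yonedaEquiv (yonedaEquiv.symm w ≫ (show (col W).obj j ⟶ Z.1.obj k from f)) =
      yonedaEquiv (yonedaEquiv.symm w ≫ (show (col W).obj j ⟶ Z.1.obj k from g)) at this
    rw [yonedaEquiv_comp, yonedaEquiv_comp, Equiv.apply_symm_apply] at this
    exact this
  · intro (g : (col W).obj j ⟶
      (col ((Γ (LeftExactSieve.all (Aᵒᵖ ⥤ Type v))).hom (yonedaObj A) Z)).obj k)
    let g' : ∀ i : A, W.El i j → (yoneda.obj i ⟶ Z.1.obj k) := fun i w => g.app (op i) w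
    have hg' : ∀ {i i' : A} (φ : i' ⟶ i) (w : W.El i j),
        g' i' (W.lmap φ w) = yoneda.map φ ≫ g' i w := fun φ w => g.naturality_apply φ.op w
    refine ⟨({ app := fun i => TypeCat.ofHom (fun w => yonedaEquiv (g' i.unop w))
               naturality := fun i i' φ => ?_ } : (col W).obj j ⟶ Z.1.obj k), ?_⟩
    · ext w
      exact (congrArg yonedaEquiv (hg' φ.unop w)).trans (yonedaEquiv_naturality _ φ.unop).symm
    · refine NatTrans.ext (funext fun i => ?_)
      ext (w : W.El i.unop j)
      refine (yonedaEquiv (F := Z.1.obj k)).injective ?_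
      exact (yonedaEquiv_comp _ _).trans
        (congrArg (fun t => yonedaEquiv (g' i.unop t)) (Equiv.apply_symm_apply _ _))

variable {W}

lemma IsAbsolute.exists_section (h : W.IsAbsolute) (j : B) :
    ∃ (i : A) (r : (col W).obj j ⟶ yoneda.obj i) (s : yoneda.obj i ⟶ (col W).obj j),
      r ≫ s = 𝟙 _ := by
  let K : (Aᵒᵖ ⥤ Type v) ⥤ Type v := coyoneda.obj (op ((col W).obj j))
  have hK : (LeftExactSieve.all (Aᵒᵖ ⥤ Type v)).IsPartiallyLex (LeftExactSieve.all (Type v)) K :=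
    fun {Q X} hX => by
      have : PreservesFiniteLimits X := hX
      exact inferInstanceAs (PreservesFiniteLimits (X ⋙ K))
  have ht := fun Q : FLCat.{v} =>
    (LexProfCat.isTensor_iff_bijective _ (yonedaUnit W ≫ (Γmap K hK).map _ _)).1
    (h _ _ (Γmap K hK) _ _ _ (yonedaUnit_isTensor W)) (E := Q)
  have key : ∀ (S : Type v) (p q : ((col W).obj j ⟶ (col W).obj j) → S),
      (∀ (i : A) (r : (col W).obj j ⟶ yoneda.obj i) (s : yoneda.obj i ⟶ (col W).obj j),
        p (r ≫ s) = q (r ≫ s)) → p (𝟙 _) = q (𝟙 _) := by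
    intro S p q hpq
    obtain ⟨Q, Z, hZ, k, rfl⟩ := exists_lex_functor S
    have hinj := (ht Q ⟨Z, hZ⟩ j k).1
    have : TypeCat.ofHom p = TypeCat.ofHom q := by
      refine @hinj (TypeCat.ofHom p) (TypeCat.ofHom q) ?_
      refine NatTrans.ext (funext fun i => ?_)
      ext w
      change TypeCat.ofHom _ = TypeCat.ofHom _
      ext r
      exact hpq _ r (yonedaEquiv.symm w)
    exact congrArg (fun t : (K.obj ((col W).obj j) ⟶ Z.obj k) => t (𝟙 _)) this
  have := key (ULift Prop) (fun _ => ⟨True⟩)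
    (fun t => ⟨∃ (i : A) (r : (col W).obj j ⟶ yoneda.obj i) (s : yoneda.obj i ⟶ (col W).obj j),
      r ≫ s = t⟩) (fun i r s => by
        refine congrArg ULift.up ?_
        simp only [eq_iff_iff, true_iff]
        exact ⟨i, r, s, rfl⟩)
  exact (congrArg ULift.down this).mp trivial

lemma IsAbsolute.mem_essImage (h : W.IsAbsolute) (j : B) :
    yoneda.essImage ((col W).obj j) := by
  obtain ⟨i, r, s, hrs⟩ := h.exists_section j
  have : IsIdempotentComplete A :=
    Idempotents.isIdempotentComplete_iff_hasEqualizer_of_id_and_idempotent A |>.2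
      fun _ _ _ => inferInstance
  obtain ⟨c, m, e, hme, hem⟩ := IsIdempotentComplete.idempotents_split i
    (yoneda.preimage (s ≫ r)) (yoneda.map_injective (by
      simp only [Functor.map_comp, Functor.map_preimage, Category.assoc, reassoc_of% hrs]))
  have hem' : yoneda.map e ≫ yoneda.map m = s ≫ r := by
    rw [← Functor.map_comp, hem, Functor.map_preimage]
  have hme' : yoneda.map m ≫ yoneda.map e = 𝟙 _ := by
    rw [← Functor.map_comp, hme, CategoryTheory.Functor.map_id]
  refine ⟨c, ⟨⟨yoneda.map m ≫ s, r ≫ yoneda.map e, ?_, ?_⟩⟩⟩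
  · rw [Category.assoc, ← reassoc_of% hem', hme', Category.comp_id, hme']
  · rw [Category.assoc, reassoc_of% hem', hrs, Category.comp_id, hrs]

lemma IsAbsolute.exists_rep (h : W.IsAbsolute) :
    ∃ (F : B ⥤ A) (_ : PreservesFiniteLimits F), Nonempty (rep F ≅ W) := by
  let F : B ⥤ A := Functor.essImage.liftFunctor (col W) yoneda h.mem_essImage
  let e : F ⋙ yoneda ≅ col W := Functor.essImage.liftFunctorCompIso _ _ _
  have : PreservesFiniteLimits (F ⋙ yoneda) := preservesFiniteLimits_of_natIso e.symm
  have hF : PreservesFiniteLimits F := preservesFiniteLimits_of_reflects_of_preserves F yoneda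
  let f : rep F ⟶ W := homMk (fun {i j} φ => (e.hom.app j).app (op i) φ)
    (fun {_ _} φ {j} x => (e.hom.app j).naturality_apply φ.op x)
    (fun {i _ _} ψ x => congrArg (fun t => t.app (op i) x) (e.hom.naturality ψ))
  have : IsIso f := (LexProf.isIso_iff f).2 fun i j =>
    (isIso_iff_bijective _).1 (inferInstanceAs (IsIso ((e.hom.app j).app (op i))))
  exact ⟨F, hF, ⟨asIso f⟩⟩

end LexProf

namespace LexProfCat

lemma IsAbsoluteTensored.exists_iso {C : LexProfCat.{v}} (h : C.IsAbsoluteTensored)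
    {A B : FLCat.{v}} (F : B ⥤ A) [PreservesFiniteLimits F] (X : C.Obj A) :
    ∃ Y : C.Obj B, Nonempty (F ⋙ IntCat.ι X ≅ IntCat.ι Y) := by
  obtain ⟨Y, u, hu⟩ := h (rep F) (isAbsolute_of_iso (Iso.refl _)) X
  exact ⟨Y, hu.exists_iso _ (Iso.refl _)⟩

end LexProfCat

lemma Γ_isAbsoluteTensored {C : Type (v + 1)} [Category.{v} C] (S : LeftExactSieve C) :
    (Γ S).IsAbsoluteTensored := by
  intro A B W hW X
  obtain ⟨F, hF, ⟨e⟩⟩ := hW.exists_rep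
  let Y : (Γ S).Obj B := ⟨F ⋙ X.1, S.precomp F hF X.2⟩
  let u : rep F ⟶ (Γ S).hom X Y := homMk (fun {i j} (φ : i ⟶ F.obj j) => X.1.map φ)
    (fun _ _ _ => X.1.map_comp _ _) (fun _ _ => X.1.map_comp _ _)
  refine ⟨Y, e.inv ≫ u, ?_⟩
  rw [LexProfCat.isTensor_iff_isIso _ e]
  intro j
  have : (Γ S).genHom e.hom (e.inv ≫ u) j =
      (show X.1.obj (F.obj j) ⟶ X.1.obj (F.obj j) from 𝟙 _) := by
    change ap u (ap (e.hom ≫ e.inv) _) = _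
    rw [e.hom_inv_id]
    exact X.1.map_id _
  refine ⟨(show X.1.obj (F.obj j) ⟶ X.1.obj (F.obj j) from 𝟙 _), ?_, ?_⟩
  · rw [this]
    exact (Category.comp_id (X := X.1.obj (F.obj j)) _).trans (X.1.map_id _).symm
  · rw [this]
    exact (Category.comp_id (X := X.1.obj (F.obj j)) _).trans ((F ⋙ X.1).map_id j).symm

/-! ### The free completion under absolute tensors -/

namespace IntCat

/-- `∫` on enriched functors and transformations. -/
def mapFunctor (C D : LexProfCat.{v}) : LexProfFunctor C D ⥤ IntCat C ⥤ IntCat D where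
  obj F := map F
  map α :=
    { app := fun p => LexProfFunctor.Trans.app α p.obj p.pt
      naturality := fun p q f => LexProfFunctor.Trans.naturality α p.obj q.obj f }

/-- Enriched transformations are the same as transformations of the functors `∫ F`. -/
def fullyFaithfulMapFunctor (C D : LexProfCat.{v}) : (mapFunctor C D).FullyFaithful where
  preimage β :=
    { app := fun X i => β.app ⟨_, X, i⟩
      naturality := fun X Y i j f => β.naturality (X := ⟨_, X, i⟩) (Y := ⟨_, Y, j⟩) f }

instance (C D : LexProfCat.{v}) : (mapFunctor C D).Full := (fullyFaithfulMapFunctor C D).full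

instance (C D : LexProfCat.{v}) : (mapFunctor C D).Faithful :=
  (fullyFaithfulMapFunctor C D).faithful

variable {C : Type (v + 1)} [Category.{v} C] (S : LeftExactSieve C)

/-- The counit `∫ Γ(C) ⥤ C`. -/
def evalΓ : IntCat (Γ S) ⥤ C where
  obj p := p.obj.1.obj p.pt
  map f := f
  map_id p := p.obj.1.map_id p.pt
  map_comp _ _ := rfl

instance : (evalΓ S).Full := ⟨fun f => ⟨f, rfl⟩⟩

instance : (evalΓ S).Faithful := ⟨fun h => h⟩

instance : (evalΓ S).EssSurj where
  mem_essImage c := by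
    obtain ⟨A, X, hX, a, rfl⟩ := S.cover c
    exact ⟨⟨A, ⟨X, hX⟩, a⟩, ⟨Iso.refl _⟩⟩

instance : (evalΓ S).IsEquivalence where

instance (D : LexProfCat.{v}) : (map (unitΓ D)).IsEquivalence := by
  let e : map (unitΓ D) ⋙ evalΓ (sieve D) ≅ 𝟭 _ :=
    NatIso.ofComponents (fun p => Iso.refl _) (fun f => by
      change (show _ ⟶ _ from f) ≫ 𝟙 _ = 𝟙 _ ≫ f
      rw [Category.comp_id, Category.id_comp])
  have : (map (unitΓ D) ⋙ evalΓ (sieve D)).IsEquivalence := Functor.isEquivalence_of_iso e.symm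
  exact Functor.isEquivalence_of_comp_right _ (evalΓ (sieve D))

end IntCat

open IntCat

section

variable {A B B' C D : Type*} [Category* A] [Category* B] [Category* B'] [Category* C]
  [Category* D] {K : C ⥤ D}
  {P : A ⥤ C} {Q : B ⥤ C} {R : B' ⥤ C} {P' : A ⥤ D} {Q' : B ⥤ D} {R' : B' ⥤ D}
  (φ : P ⋙ K ≅ P') (ψ : Q ⋙ K ≅ Q') (χ : R ⋙ K ≅ R')

/-- The action of a functor `K` on morphisms, transported along isomorphisms. -/
def conjMap {i : A} {j : B} (f : P.obj i ⟶ Q.obj j) : P'.obj i ⟶ Q'.obj j :=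
  φ.inv.app i ≫ K.map f ≫ ψ.hom.app j

lemma conjMap_map_comp {i' i : A} {j : B} (a : i' ⟶ i) (f : P.obj i ⟶ Q.obj j) :
    conjMap φ ψ (P.map a ≫ f) = P'.map a ≫ conjMap φ ψ f := by
  simp [conjMap]

lemma conjMap_comp_map {i : A} {j j' : B} (b : j ⟶ j') (f : P.obj i ⟶ Q.obj j) :
    conjMap φ ψ (f ≫ Q.map b) = conjMap φ ψ f ≫ Q'.map b := by
  have := ψ.hom.naturality b
  dsimp only [Functor.comp_map] at this
  simp [conjMap, this]

lemma conjMap_map {i j : A} (a : i ⟶ j) : conjMap φ φ (P.map a) = P'.map a := by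
  have := φ.hom.naturality a
  dsimp only [Functor.comp_map] at this
  simp [conjMap, this]

lemma conjMap_comp {i : A} {j : B} {k : B'} (f : P.obj i ⟶ Q.obj j) (g : Q.obj j ⟶ R.obj k) :
    conjMap φ χ (f ≫ g) = conjMap φ ψ f ≫ conjMap ψ χ g := by
  simp [conjMap]

lemma conjMap_comp_inv {i : A} {j : B} (f : P.obj i ⟶ Q.obj j) :
    conjMap φ ψ f ≫ ψ.inv.app j = φ.inv.app i ≫ K.map f := by
  simp [conjMap]

end

variable {C E : LexProfCat.{v}}

instance : ((unitΓ C).precomp E).Faithful :=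
  Functor.Faithful.of_comp_iso (F := (unitΓ C).precomp E) (G := mapFunctor C E)
    (H := mapFunctor _ E ⋙ (Functor.whiskeringLeft _ _ _).obj (map (unitΓ C))) (Iso.refl _)

instance : ((unitΓ C).precomp E).Full :=
  Functor.Full.of_comp_faithful_iso (F := (unitΓ C).precomp E) (G := mapFunctor C E)
    (H := mapFunctor _ E ⋙ (Functor.whiskeringLeft _ _ _).obj (map (unitΓ C))) (Iso.refl _)

lemma exists_extension_obj (hE : E.IsAbsoluteTensored) (K : LexProfFunctor C E) {A : FLCat.{v}}
    (P : (Γ (sieve C)).Obj A) :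
    ∃ Z : E.Obj A, Nonempty (P.1 ⋙ map K ≅ ι Z) := by
  obtain ⟨P, B, Y, F, hF, ⟨e⟩⟩ := P
  obtain ⟨Z, ⟨e'⟩⟩ := hE.exists_iso F (K.obj Y)
  exact ⟨Z, ⟨Functor.isoWhiskerRight e (map K) ≪≫
    Functor.isoWhiskerLeft F (eqToIso (ι_map K Y)) ≪≫ e'⟩⟩

/-- The extension of an enriched functor along `C ⟶ Γ(∫ C)`, from a choice of its values. -/
def extension (K : LexProfFunctor C E)
    (G : ∀ {A : FLCat.{v}}, (Γ (sieve C)).Obj A → E.Obj A)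
    (φ : ∀ {A : FLCat.{v}} (P : (Γ (sieve C)).Obj A), P.1 ⋙ map K ≅ ι (G P)) :
    LexProfFunctor (Γ (sieve C)) E where
  obj P := G P
  map P Q := homMk
    (fun {i j} (f : P.1.obj i ⟶ Q.1.obj j) => conjMap (φ P) (φ Q) f)
    (fun {_ i} a {j} (f : P.1.obj i ⟶ Q.1.obj j) =>
      (conjMap_map_comp (φ P) (φ Q) a f).trans (E.idMap_comp (G P) (G Q) a _))
    (fun {i j _} b (f : P.1.obj i ⟶ Q.1.obj j) =>
      (conjMap_comp_map (φ P) (φ Q) b f).trans (E.comp_idMap (G P) (G Q) _ b))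
  map_ident P := hom_ext fun _ _ a => conjMap_map (φ P) a
  map_comp P Q R _ _ _ f g := conjMap_comp (φ P) (φ Q) (φ R) f g

/-- The extension of an enriched functor along `C ⟶ Γ(∫ C)` restricts to that functor. -/
def unitExtensionIso (K : LexProfFunctor C E)
    (G : ∀ {A : FLCat.{v}}, (Γ (sieve C)).Obj A → E.Obj A)
    (φ : ∀ {A : FLCat.{v}} (P : (Γ (sieve C)).Obj A), P.1 ⋙ map K ≅ ι (G P)) :
    (unitΓ C).comp (extension K G φ) ≅ K :=
  (fullyFaithfulMapFunctor C E).preimageIso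
    (NatIso.ofComponents (fun p => ((φ ((unitΓ C).obj p.obj)).app p.pt).symm) (fun {p q} f =>
      conjMap_comp_inv (φ ((unitΓ C).obj p.obj)) (φ ((unitΓ C).obj q.obj)) f))

/-- The enriched functor `C ⟶ Γ(∫ C)` is the free completion under absolute tensors. -/
theorem unitΓ_isFreeAbsoluteCompletion (C : LexProfCat.{v}) :
    (unitΓ C).IsFreeAbsoluteCompletion where
  tensored := Γ_isAbsoluteTensored _
  universal E hE :=
    { essSurj := ⟨fun K => by
        choose G φ using fun (A : FLCat.{v}) (P : (Γ (sieve C)).Obj A) =>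
          exists_extension_obj hE K P
        exact ⟨extension K (fun {A} P => G A P) (fun {A} P => (φ A P).some),
          ⟨unitExtensionIso K _ _⟩⟩⟩ }

/-! ### Morphisms of categories under `A` with the same objects -/

namespace IdOnObj

variable {A : FLCat.{v}} {L L' L'' : IdOnObj A}

namespace Mor

lemma obj_eq (F : Mor L L') (a : A) : F.functor.obj (L.J.obj a) = L'.J.obj a :=
  Functor.congr_obj F.comm a

/-- The action on morphisms of a functor under `A`. -/
def onHom (F : Mor L L') {a b : A} (f : L.J.obj a ⟶ L.J.obj b) : L'.J.obj a ⟶ L'.J.obj b :=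
  eqToHom (F.obj_eq a).symm ≫ F.functor.map f ≫ eqToHom (F.obj_eq b)

lemma onHom_map (F : Mor L L') {a b : A} (φ : a ⟶ b) : F.onHom (L.J.map φ) = L'.J.map φ := by
  have h := Functor.congr_hom F.comm φ
  rw [Functor.comp_map] at h
  rw [onHom, h]
  simp

lemma onHom_comp (F : Mor L L') {a b c : A} (f : L.J.obj a ⟶ L.J.obj b)
    (g : L.J.obj b ⟶ L.J.obj c) : F.onHom (f ≫ g) = F.onHom f ≫ F.onHom g := by
  simp [onHom]

lemma onHom_id_functor {a b : A} (f : L.J.obj a ⟶ L.J.obj b) :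
    onHom (⟨𝟭 _, rfl⟩ : Mor L L) f = f := by
  simp [onHom]

lemma onHom_comp_functor (F : Mor L L') (G : Mor L' L'') (h) {a b : A}
    (f : L.J.obj a ⟶ L.J.obj b) :
    onHom (⟨F.functor ⋙ G.functor, h⟩ : Mor L L'') f = G.onHom (F.onHom f) := by
  simp [onHom, eqToHom_map]

lemma ext_onHom {F G : Mor L L'}
    (h : ∀ {a b : A} (f : L.J.obj a ⟶ L.J.obj b), F.onHom f = G.onHom f) : F = G := by
  have key : ∀ {a b : A} (f : L.J.obj a ⟶ L.J.obj b), F.functor.map f =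
      eqToHom ((F.obj_eq a).trans (G.obj_eq a).symm) ≫ G.functor.map f ≫
        eqToHom ((G.obj_eq b).trans (F.obj_eq b).symm) := by
    intro a b f
    have hf := h f
    rw [onHom, onHom, eqToHom_comp_iff, comp_eqToHom_iff] at hf
    exact hf.trans (by simp only [Category.assoc, eqToHom_trans, eqToHom_trans_assoc])
  exact Mor.ext (CategoryTheory.Functor.ext _ (fun (a b : A) f => key f))

/-- A functor under `A` from its action on morphisms. -/
def ofHom (f : ∀ {a b : A}, (L.J.obj a ⟶ L.J.obj b) → (L'.J.obj a ⟶ L'.J.obj b))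
    (hmap : ∀ {a b : A} (φ : a ⟶ b), f (L.J.map φ) = L'.J.map φ)
    (hcomp : ∀ {a b c : A} (x : L.J.obj a ⟶ L.J.obj b) (y : L.J.obj b ⟶ L.J.obj c),
      f (x ≫ y) = f x ≫ f y) : Mor L L' where
  functor :=
    { obj := fun a => L'.J.obj a
      map := fun {a b : A} x => f x
      map_id := fun (a : A) => (congrArg f (L.J.map_id a).symm).trans
        ((hmap _).trans (L'.J.map_id a))
      map_comp := fun {a b c : A} x y => hcomp x y }
  comm := CategoryTheory.Functor.ext (fun _ => rfl) (fun a b φ => by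
    change _ = 𝟙 (L'.J.obj a) ≫ L'.J.map φ ≫ 𝟙 (L'.J.obj b)
    rw [Category.id_comp, Category.comp_id]
    exact hmap φ)

lemma onHom_ofHom (f : ∀ {a b : A}, (L.J.obj a ⟶ L.J.obj b) → (L'.J.obj a ⟶ L'.J.obj b))
    (hmap hcomp) {a b : A} (x : L.J.obj a ⟶ L.J.obj b) :
    (ofHom (L := L) (L' := L') f hmap hcomp).onHom x = f x := by
  change 𝟙 (L'.J.obj a) ≫ f x ≫ 𝟙 (L'.J.obj b) = f x
  rw [Category.id_comp, Category.comp_id]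

end Mor

lemma onHom_ofFunctorMap {C : Type u} [Category.{v} C] {D : Type u'} [Category.{v} D] {K : A ⥤ C}
    {K' : A ⥤ D} (F : C ⥤ D) (h : K ⋙ F = K') {a b : A} (f : K.obj a ⟶ K.obj b) :
    (ofFunctorMap F h).onHom f =
      (eqToHom (Functor.congr_obj h a).symm ≫ F.map f ≫ eqToHom (Functor.congr_obj h b) :
        K'.obj a ⟶ K'.obj b) := by
  subst h
  change 𝟙 _ ≫ (𝟙 _ ≫ F.map f ≫ 𝟙 _) ≫ 𝟙 _ = _
  simp

end IdOnObj

namespace LawvereTheory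

variable {A : FLCat.{v}} {L L' : LawvereTheory A}

/-- An isomorphism of Lawvere theories from bijections on morphisms. -/
noncomputable def isoOfBijective (F : L ⟶ L')
    (h : ∀ a b : A, Function.Bijective
      (IdOnObj.Mor.onHom F : (L.J.obj a ⟶ L.J.obj b) → (L'.J.obj a ⟶ L'.J.obj b))) :
    L ≅ L' where
  hom := F
  inv := IdOnObj.Mor.ofHom (fun {a b} => (Equiv.ofBijective _ (h a b)).symm)
    (fun φ => (Equiv.symm_apply_eq _).2 (IdOnObj.Mor.onHom_map F φ).symm)
    (fun {a b c} x y => (Equiv.symm_apply_eq _).2 (by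
      refine Eq.trans ?_ (IdOnObj.Mor.onHom_comp F _ _).symm
      exact congrArg₂ _ (Equiv.apply_symm_apply (Equiv.ofBijective _ (h a b)) x).symm
        (Equiv.apply_symm_apply (Equiv.ofBijective _ (h b c)) y).symm))
  hom_inv_id := IdOnObj.Mor.ext_onHom fun {a b} f => by
    refine (IdOnObj.Mor.onHom_comp_functor F _ _ f).trans (Eq.trans ?_
      (IdOnObj.Mor.onHom_id_functor f).symm)
    exact (IdOnObj.Mor.onHom_ofHom _ _ _ _).trans
      (Equiv.symm_apply_apply (Equiv.ofBijective _ (h a b)) f)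
  inv_hom_id := IdOnObj.Mor.ext_onHom fun {a b} f => by
    refine (IdOnObj.Mor.onHom_comp_functor _ F _ f).trans (Eq.trans ?_
      (IdOnObj.Mor.onHom_id_functor f).symm)
    exact (congrArg (IdOnObj.Mor.onHom F) (IdOnObj.Mor.onHom_ofHom _ _ _ _)).trans
      (Equiv.apply_symm_apply (Equiv.ofBijective _ (h a b)) f)

end LawvereTheory

/-! ### The sieve of a Lawvere enriched category is determined by its Lawvere theory -/

namespace LawvereLexProfCat

variable {A : FLCat.{v}}

instance : (toLawvereTheory A).Faithful where
  map_injective {_ _} _ _ h := Mor.ext (congrArg IdOnObj.Mor.functor h)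

instance : (toLawvereTheory A).Full where
  map_surjective {L L'} F := by
    refine ⟨⟨F, fun {B X} hX => ?_⟩, rfl⟩
    obtain ⟨G, hG, ⟨e⟩⟩ := L.reflecting hX
    refine L'.sieve.iso ?_ (L'.partiallyLex hG)
    exact Functor.isoWhiskerLeft G (eqToIso (IdOnObj.Mor.comm F).symm) ≪≫
      Functor.isoWhiskerRight e (IdOnObj.Mor.functor F)

/-- The Lawvere enriched category of a Lawvere theory. -/
def ofLawvereTheory (L : LawvereTheory A) : LawvereLexProfCat A where
  toIdOnObj := L.toIdOnObj
  sieve :=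
    { mem := fun X => ∃ G : _ ⥤ A, PreservesFiniteLimits G ∧ Nonempty (G ⋙ L.J ≅ X)
      lex := by
        rintro B X ⟨G, hG, ⟨e⟩⟩
        have := L.lex
        exact preservesFiniteLimits_of_natIso e
      precomp := by
        rintro B B' X H hH ⟨G, hG, ⟨e⟩⟩
        exact ⟨H ⋙ G, inferInstance, ⟨Functor.isoWhiskerLeft H e⟩⟩
      iso := by
        rintro B X Y e ⟨G, hG, ⟨e'⟩⟩
        exact ⟨G, hG, ⟨e' ≪≫ e⟩⟩
      cover := fun a => ⟨A, L.J, ⟨𝟭 _, inferInstance, ⟨Iso.refl _⟩⟩, a, rfl⟩ }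
  partiallyLex {_ G} hG := ⟨G, hG, ⟨Iso.refl _⟩⟩
  reflecting h := h

instance : (toLawvereTheory A).EssSurj where
  mem_essImage L := ⟨ofLawvereTheory L, ⟨Iso.refl _⟩⟩

instance : (toLawvereTheory A).IsEquivalence where

end LawvereLexProfCat

/-! ### One-object enriched categories and Lawvere theories -/

namespace OneObjCat

variable {A : FLCat.{v}}

/-- Induction on the objects of a one-object enriched category. -/
def elim (T : OneObjCat A) {motive : (Σ B, T.cat.Obj B) → Sort*} (m : motive ⟨A, T.star⟩)
    {B : FLCat.{v}} (X : T.cat.Obj B) : motive ⟨B, X⟩ :=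
  (T.eq_star X).symm ▸ m

/-- Functors out of a one-object enriched category. -/
def lift (T : OneObjCat A) {D : LexProfCat.{v}} (Y : D.Obj A)
    (θ : T.cat.hom T.star T.star ⟶ D.hom Y Y)
    (hid : T.cat.ident T.star ≫ θ = D.ident Y)
    (hcomp : ∀ {i j k : A} (f : (T.cat.hom T.star T.star).El i j)
      (g : (T.cat.hom T.star T.star).El j k),
      ap θ ((T.cat.comp T.star T.star T.star).fn f g) = (D.comp Y Y Y).fn (ap θ f) (ap θ g)) :
    LexProfFunctor T.cat D where
  obj X := T.elim (motive := fun p => D.Obj p.1) Y X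
  map X Z := T.elim
    (motive := fun p => T.cat.hom p.2 Z ⟶
      D.hom (T.elim (motive := fun p => D.Obj p.1) Y p.2)
        (T.elim (motive := fun p => D.Obj p.1) Y Z))
    (T.elim (motive := fun p => T.cat.hom T.star p.2 ⟶
      D.hom Y (T.elim (motive := fun p => D.Obj p.1) Y p.2)) θ Z) X
  map_ident X := by
    obtain ⟨rfl, h⟩ := Sigma.mk.inj (T.eq_star X)
    obtain rfl := eq_of_heq h
    exact hid
  map_comp X Z W i j k f g := by
    obtain ⟨rfl, h⟩ := Sigma.mk.inj (T.eq_star X)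
    obtain rfl := eq_of_heq h
    obtain ⟨rfl, h⟩ := Sigma.mk.inj (T.eq_star Z)
    obtain rfl := eq_of_heq h
    obtain ⟨rfl, h⟩ := Sigma.mk.inj (T.eq_star W)
    obtain rfl := eq_of_heq h
    exact hcomp f g

lemma functor_ext {T T' : OneObjCat A} {F G : LexProfFunctor T.cat T'.cat}
    (h : ∀ {i j : A} (f : (T.cat.hom T.star T.star).El i j),
      HEq (ap (F.map T.star T.star) f) (ap (G.map T.star T.star) f)) : F = G := by
  have hobj : @F.obj = @G.obj := by
    funext B X
    exact eq_of_heq (Sigma.mk.inj ((T'.eq_star (F.obj X)).trans (T'.eq_star (G.obj X)).symm)).2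
  obtain ⟨obj, map, _, _⟩ := F
  obtain ⟨obj', map', _, _⟩ := G
  obtain rfl : @obj = @obj' := hobj
  refine LexProfFunctor.ext rfl (heq_of_eq ?_)
  funext B C X Y
  obtain ⟨rfl, hX⟩ := Sigma.mk.inj (T.eq_star X)
  obtain rfl := eq_of_heq hX
  obtain ⟨rfl, hY⟩ := Sigma.mk.inj (T.eq_star Y)
  obtain rfl := eq_of_heq hY
  exact hom_ext fun i j f => eq_of_heq (h f)

/-- The Lawvere theory of a one-object enriched category. -/
abbrev toTheory (A : FLCat.{v}) : OneObjCat A ⥤ LawvereTheory A :=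
  toLawvere A ⋙ LawvereLexProfCat.toLawvereTheory A

lemma toTheory_map_onHom_heq {T T' : OneObjCat A} (F : T ⟶ T') {i j : A}
    (f : (T.cat.hom T.star T.star).El i j) :
    HEq (IdOnObj.Mor.onHom ((toTheory A).map F) (a := i) (b := j) f)
      (ap (LexProfFunctor.map F T.star T.star) f) := by
  have := IdOnObj.onHom_ofFunctorMap (IntCat.map F) (J_map F) (a := i) (b := j) f
  refine (heq_of_eq this).trans ?_
  refine (eqToHom_comp_heq _ _).trans ((comp_eqToHom_heq _ _).trans ?_)
  rfl

instance : (toTheory A).Faithful where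
  map_injective {_ _} F G h := functor_ext fun f =>
    (toTheory_map_onHom_heq F f).symm.trans ((heq_of_eq (by rw [h])).trans
      (toTheory_map_onHom_heq G f))

instance : (toTheory A).Full where
  map_surjective {T T'} H := by
    let F : T ⟶ T' := T.lift T'.star
      (homMk (fun {i j} f => IdOnObj.Mor.onHom H (a := i) (b := j) f)
        (fun {i' i} φ {j} f =>
          (congrArg (IdOnObj.Mor.onHom H) (T.cat.idMap_comp T.star T.star φ f).symm).trans
            ((IdOnObj.Mor.onHom_comp H (a := i') (b := i) (c := j) _ _).trans ((congrArg
              (fun t : ((toTheory A).obj T').J.obj i' ⟶ ((toTheory A).obj T').J.obj i =>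
                t ≫ IdOnObj.Mor.onHom H (a := i) (b := j) f)
              (IdOnObj.Mor.onHom_map H φ)).trans (T'.cat.idMap_comp T'.star T'.star φ _))))
        (fun {i j j'} ψ f =>
          (congrArg (IdOnObj.Mor.onHom H) (T.cat.comp_idMap T.star T.star f ψ).symm).trans
            ((IdOnObj.Mor.onHom_comp H (a := i) (b := j) (c := j') _ _).trans ((congrArg
              (fun t : ((toTheory A).obj T').J.obj j ⟶ ((toTheory A).obj T').J.obj j' =>
                IdOnObj.Mor.onHom H (a := i) (b := j) f ≫ t)
              (IdOnObj.Mor.onHom_map H ψ)).trans (T'.cat.comp_idMap T'.star T'.star _ ψ)))))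
      (hom_ext fun i j φ => IdOnObj.Mor.onHom_map H (a := i) (b := j) φ)
      (fun {i j k} f g => IdOnObj.Mor.onHom_comp H (a := i) (b := j) (c := k) f g)
    exact ⟨F, IdOnObj.Mor.ext_onHom fun f => eq_of_heq (toTheory_map_onHom_heq F f)⟩

/-- The one-object enriched category of a Lawvere theory. -/
def ofTheory (L : LawvereTheory A) : OneObjCat A :=
  ofMonad
    { obj := fun i => ⟨L.J ⋙ coyoneda.obj (op (L.J.obj i.unop)), by
        have := L.lex
        simp only [leftExactFunctor_iff]; infer_instance⟩
      map := fun φ => ObjectProperty.homMk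
        (Functor.whiskerLeft L.J (coyoneda.map (L.J.map φ.unop).op)) }
    { fn := fun {i j k} (f : L.Hom i j) (g : L.Hom j k) => (L.comp f g : L.Hom i k)
      fn_lmap := fun _ _ _ => L.assoc _ _ _
      fn_rmap := fun _ _ _ => (L.assoc _ _ _).symm
      dinatural := fun _ _ _ => L.assoc _ _ _ }
    (homMk (fun {i j} (φ : i ⟶ j) => (L.map φ : L.Hom i j))
      (fun _ _ _ => L.map_comp _ _) (fun _ _ => L.map_comp _ _))
    (fun {i j} (f : L.Hom i j) => by
      exact (congrArg (fun t => L.comp t f) (L.map_id i)).trans (L.id_comp f))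
    (fun {i j} (f : L.Hom i j) => by
      exact (congrArg (fun t => L.comp f t) (L.map_id j)).trans (L.comp_id f))
    (fun f g h => L.assoc f g h)

instance : (toTheory A).EssSurj where
  mem_essImage L := ⟨ofTheory L, ⟨LawvereTheory.isoOfBijective
    (IdOnObj.Mor.ofHom (fun {a b} f => f) (fun _ => rfl) (fun _ _ => rfl)) (fun a b => by
      have : (IdOnObj.Mor.onHom (IdOnObj.Mor.ofHom (L := ((toTheory A).obj (ofTheory L)).toIdOnObj)
          (L' := L.toIdOnObj) (fun {a b} f => f) (fun _ => rfl) (fun _ _ => rfl)) :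
            (((toTheory A).obj (ofTheory L)).J.obj a ⟶ ((toTheory A).obj (ofTheory L)).J.obj b) →
            (L.J.obj a ⟶ L.J.obj b)) = fun f => f :=
        funext fun f => IdOnObj.Mor.onHom_ofHom _ _ _ f
      exact this ▸ Function.bijective_id)⟩⟩

instance : (toTheory A).IsEquivalence where

instance : (toLawvere A).IsEquivalence :=
  Functor.isEquivalence_of_comp_right _ (LawvereLexProfCat.toLawvereTheory A)

end OneObjCat

/-! ### Finitely presentable objects are dense -/

namespace FPModel

variable {A : Type (v + 1)} [LargeCategory.{v} A] (M : FPModel A)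

instance isFinitelyPresentable (i : M.carrier) : IsFinitelyPresentable.{v} (M.ι.obj i) :=
  (M.essImage_iff _).1 (M.ι.obj_mem_essImage i)

variable [IsLocallyFinitelyPresentable.{v} A]

instance : M.ι.IsDense := by
  have := Cardinal.fact_isRegular_aleph0.{v}
  have := M.toFullSubcategory_isEquivalence
  have : (M.toFullSubcategory ⋙ (ObjectProperty.isFinitelyPresentable.{v} A).ι).IsDense :=
    inferInstance
  exact this

instance (X : A) : IsFiltered (CostructuredArrow M.ι X) :=
  have := coflat_of_preservesFiniteColimits M.ι
  RepresentablyCoflat.filtered X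

/-- The cocone exhibiting an object as a colimit of finitely presentable objects. -/
abbrev canonicalCocone (X : A) : Cocone (CostructuredArrow.proj M.ι X ⋙ M.ι) where
  pt := X
  ι :=
    { app := fun g => g.hom
      naturality := fun _ _ a => (CostructuredArrow.w a).trans (Category.comp_id _).symm }

/-- Every object is the colimit of the finitely presentable objects above it. -/
noncomputable def isColimitCanonicalCocone (X : A) : IsColimit (M.canonicalCocone X) :=
  (M.ι.denseAt X).ofIsoColimit (Cocone.ext (Iso.refl _) (fun g =>
    (Category.comp_id _).trans (Category.id_comp g.hom)))

variable {M} in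
lemma hom_ext {X Y : A} {f g : X ⟶ Y} (h : ∀ (i : M.carrier) (x : M.ι.obj i ⟶ X),
    x ≫ f = x ≫ g) : f = g :=
  (M.isColimitCanonicalCocone X).hom_ext fun x => h _ x.hom

variable {X Y : A} (T : A ⥤ A) [PreservesFilteredColimits T]

variable {M} in
lemma map_hom_ext {f g : T.obj X ⟶ Y} (h : ∀ (i : M.carrier) (x : M.ι.obj i ⟶ X),
    T.map x ≫ f = T.map x ≫ g) : f = g :=
  (isColimitOfPreserves T (M.isColimitCanonicalCocone X)).hom_ext fun x => h _ x.hom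

lemma exists_desc (t : ∀ {i : M.carrier}, (M.ι.obj i ⟶ X) → (T.obj (M.ι.obj i) ⟶ Y))
    (ht : ∀ {i j : M.carrier} (a : i ⟶ j) (x : M.ι.obj j ⟶ X),
      t (M.ι.map a ≫ x) = T.map (M.ι.map a) ≫ t x) :
    ∃ f : T.obj X ⟶ Y, ∀ {i : M.carrier} (x : M.ι.obj i ⟶ X), T.map x ≫ f = t x := by
  let c : Cocone ((CostructuredArrow.proj M.ι X ⋙ M.ι) ⋙ T) :=
    { pt := Y
      ι :=
        { app := fun x => t x.hom
          naturality := fun x y a => by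
            have := ht a.left y.hom
            rw [CostructuredArrow.w] at this
            exact this.symm.trans (Category.comp_id _).symm } }
  exact ⟨(isColimitOfPreserves T (M.isColimitCanonicalCocone X)).desc c, fun {i} x =>
    (isColimitOfPreserves T (M.isColimitCanonicalCocone X)).fac c (CostructuredArrow.mk x)⟩

lemma exists_hom (t : ∀ {i : M.carrier}, (M.ι.obj i ⟶ X) → (M.ι.obj i ⟶ Y))
    (ht : ∀ {i j : M.carrier} (a : i ⟶ j) (x : M.ι.obj j ⟶ X),
      t (M.ι.map a ≫ x) = M.ι.map a ≫ t x) :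
    ∃ f : X ⟶ Y, ∀ {i : M.carrier} (x : M.ι.obj i ⟶ X), x ≫ f = t x :=
  M.exists_desc (𝟭 A) t ht

lemma exists_factor {j : M.carrier} (g : M.ι.obj j ⟶ T.obj X) :
    ∃ (i : M.carrier) (x : M.ι.obj i ⟶ X) (g' : M.ι.obj j ⟶ T.obj (M.ι.obj i)),
      g' ≫ T.map x = g := by
  obtain ⟨x, g', h⟩ := IsFinitelyPresentable.exists_hom_of_isColimit
    (isColimitOfPreserves T (M.isColimitCanonicalCocone X)) g
  exact ⟨x.left, x.hom, g', h⟩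

/-! ### The restricted Yoneda embedding -/

/-- The restricted Yoneda embedding `X ↦ A(-, X)`. -/
abbrev nerve : A ⥤ M.carrierᵒᵖ ⥤ Type v :=
  yoneda ⋙ (Functor.whiskeringLeft _ _ _).obj M.ι.op

instance : M.nerve.Faithful where
  map_injective {X Y} _ _ h := hom_ext (M := M) fun i x =>
    congrArg (fun t : M.nerve.obj X ⟶ M.nerve.obj Y => t.app (op i) x) h

instance : M.nerve.Full where
  map_surjective {X Y} t := by
    obtain ⟨f, hf⟩ := M.exists_hom (X := X) (Y := Y) (fun {i} x => t.app (op i) x)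
      (fun a x => t.naturality_apply a.op x)
    refine ⟨f, NatTrans.ext (funext fun i => ?_)⟩
    ext x
    exact hf x

instance : PreservesFilteredColimits M.nerve where
  preserves_filtered_colimits J _ _ :=
    preservesColimitsOfShape_of_evaluation _ _ fun i =>
      inferInstanceAs (PreservesColimitsOfShape J (coyoneda.obj (op (M.ι.obj i.unop))))

lemma nerve_obj_preservesFiniteLimits (X : A) : PreservesFiniteLimits (M.nerve.obj X) := by
  have : PreservesFiniteLimits M.ι.op := preservesFiniteLimits_op _
  exact inferInstanceAs (PreservesFiniteLimits (M.ι.op ⋙ yoneda.obj _))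

lemma nerve_essImage (P : M.carrierᵒᵖ ⥤ Type v) [PreservesFiniteLimits P] :
    M.nerve.essImage P := by
  have := (isFiltered_costructuredArrow_yoneda_iff_nonempty_preservesFiniteLimits P).2
    inferInstance
  let D := CostructuredArrow.proj yoneda P ⋙ M.ι
  let e : yoneda ≅ M.ι ⋙ M.nerve := NatIso.ofComponents (fun i => NatIso.ofComponents
    (fun j => ((Functor.FullyFaithful.ofFullyFaithful M.ι).homEquiv (X := j.unop) (Y := i)).toIso)
      (fun a => by
        ext x
        exact M.ι.map_comp a.unop x)) (fun a => by
        ext j x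
        exact M.ι.map_comp x a)
  let i : D ⋙ M.nerve ≅ CostructuredArrow.proj yoneda P ⋙ yoneda :=
    Functor.isoWhiskerLeft (CostructuredArrow.proj yoneda P) e.symm
  exact ⟨colimit D, ⟨(isColimitOfPreserves M.nerve (colimit.isColimit D)).coconePointsIsoOfNatIso
    (Presheaf.isColimitTautologicalCocone P) i⟩⟩

end FPModel

/-! ### Morphisms of finitary monads -/

namespace FPModel

variable {A : Type (v + 1)} [LargeCategory.{v} A] (M : FPModel A)

/-- A morphism between the categories of finitely presentable free algebras of two monads, which
is the identity on objects and on morphisms in the image of the base. -/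
structure KleisliMap (S T : Monad A) where
  toFun : ∀ {i j : M.carrier}, (M.ι.obj j ⟶ S.obj (M.ι.obj i)) → (M.ι.obj j ⟶ T.obj (M.ι.obj i))
  unit : ∀ {i j : M.carrier} (a : j ⟶ i),
    toFun (M.ι.map a ≫ S.η.app _) = M.ι.map a ≫ T.η.app _
  comp : ∀ {i j k : M.carrier} (f : M.ι.obj j ⟶ S.obj (M.ι.obj i))
    (g : M.ι.obj k ⟶ S.obj (M.ι.obj j)),
    toFun (g ≫ S.map f ≫ S.μ.app _) = toFun g ≫ T.map (toFun f) ≫ T.μ.app _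

namespace KleisliMap

variable {M} {S T : Monad A} (h : KleisliMap M S T)

lemma map_comp {i j k : M.carrier} (a : k ⟶ j) (f : M.ι.obj j ⟶ S.obj (M.ι.obj i)) :
    h.toFun (M.ι.map a ≫ f) = M.ι.map a ≫ h.toFun f := by
  have e : ∀ (T : Monad A) (f : M.ι.obj j ⟶ T.obj (M.ι.obj i)),
      (M.ι.map a ≫ T.η.app _) ≫ T.map f ≫ T.μ.app _ = M.ι.map a ≫ f := fun T f => by
    have := T.η.naturality f
    dsimp at this
    simp [← reassoc_of% this]
  have := h.comp f (M.ι.map a ≫ S.η.app _)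
  rwa [h.unit, e, e] at this

lemma comp_map {i j k : M.carrier} (a : i ⟶ k) (f : M.ι.obj j ⟶ S.obj (M.ι.obj i)) :
    h.toFun (f ≫ S.map (M.ι.map a)) = h.toFun f ≫ T.map (M.ι.map a) := by
  have := h.comp (M.ι.map a ≫ S.η.app _) f
  rw [h.unit] at this
  simpa using this

end KleisliMap

variable [IsLocallyFinitelyPresentable.{v} A] {S T : Monad A}
  [PreservesFilteredColimits (S : A ⥤ A)]

variable {M} in
lemma monadHom_ext {θ θ' : S ⟶ T}
    (h : ∀ {i j : M.carrier} (f : M.ι.obj j ⟶ S.obj (M.ι.obj i)),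
      f ≫ θ.app (M.ι.obj i) = f ≫ θ'.app (M.ι.obj i)) : θ = θ' := by
  refine MonadHom.ext (funext fun X => map_hom_ext (M := M) (S : A ⥤ A) fun i x => ?_)
  have e : ∀ θ : S ⟶ T, S.map x ≫ θ.app X = θ.app _ ≫ T.map x := fun θ => θ.naturality x
  rw [e, e, hom_ext (M := M) fun j f => h f]

lemma exists_monadHom (h : KleisliMap M S T) : ∃ θ : S ⟶ T,
    ∀ {i j : M.carrier} (f : M.ι.obj j ⟶ S.obj (M.ι.obj i)), f ≫ θ.app _ = h.toFun f := by
  choose α hα using fun i : M.carrier => M.exists_hom (X := S.obj (M.ι.obj i))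
    (Y := T.obj (M.ι.obj i)) h.toFun (fun a x => h.map_comp a x)
  have α_nat : ∀ {i j : M.carrier} (a : i ⟶ j),
      S.map (M.ι.map a) ≫ α j = α i ≫ T.map (M.ι.map a) := fun {i j} a =>
    hom_ext (M := M) fun k f => by
      rw [← Category.assoc, hα, h.comp_map, ← hα, Category.assoc]
  choose β hβ using fun X : A => M.exists_desc (X := X) (Y := T.obj X) (S : A ⥤ A)
    (fun {i} x => α i ≫ T.map x) (fun a x => by
      rw [← Category.assoc, α_nat, T.map_comp, Category.assoc])
  have β_ι : ∀ i, β (M.ι.obj i) = α i := fun i => by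
    simpa using hβ _ (𝟙 (M.ι.obj i))
  have β_nat : ∀ {X Y : A} (f : X ⟶ Y), S.map f ≫ β Y = β X ≫ T.map f := fun {X Y} f =>
    map_hom_ext (M := M) (S : A ⥤ A) fun i x => by
      rw [← Category.assoc, ← S.map_comp, hβ, ← Category.assoc, hβ, Category.assoc, T.map_comp]
  have α_unit : ∀ i, S.η.app _ ≫ α i = T.η.app (M.ι.obj i) := fun i =>
    hom_ext (M := M) fun j y => by
      obtain ⟨a, rfl⟩ := M.ι.map_surjective y
      rw [← Category.assoc, hα, h.unit]
  have α_mul : ∀ {i j : M.carrier} (g : M.ι.obj j ⟶ S.obj (M.ι.obj i)),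
      S.map g ≫ S.μ.app _ ≫ α i = α j ≫ T.map (h.toFun g) ≫ T.μ.app _ := fun {i j} g =>
    hom_ext (M := M) fun k f => by
      have := hα i (f ≫ S.map g ≫ S.μ.app _)
      simp only [Category.assoc] at this
      rw [this, h.comp, ← hα, Category.assoc]
  have unit : ∀ X, S.η.app X ≫ β X = T.η.app X := fun X => hom_ext (M := M) fun i x => by
    have e : ∀ T : Monad A, x ≫ T.η.app X = T.η.app _ ≫ T.map x := fun T => T.η.naturality x
    rw [← Category.assoc, e, e, Category.assoc]
    refine (congrArg _ (hβ X x)).trans ?_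
    rw [← Category.assoc, α_unit]
  have mul : ∀ X, S.μ.app X ≫ β X = (S.map (β X) ≫ β _) ≫ T.μ.app X := fun X =>
    map_hom_ext (M := M) (S : A ⥤ A) fun j g => by
      obtain ⟨i, x, g, rfl⟩ := M.exists_factor (S : A ⥤ A) g
      have eS : S.map (S.map x) ≫ S.μ.app X = S.μ.app _ ≫ S.map x := S.μ.naturality x
      have eT : T.map (T.map x) ≫ T.μ.app X = T.μ.app _ ≫ T.map x := T.μ.naturality x
      have e : S.map (g ≫ S.map x) ≫ S.map (β X) = S.map (h.toFun g) ≫ S.map (T.map x) := by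
        rw [← S.map_comp, ← S.map_comp, Category.assoc, hβ, ← Category.assoc, hα]
      have := hβ _ (h.toFun g)
      simp only [Category.assoc]
      rw [reassoc_of% e, reassoc_of% (β_nat (T.map x)), reassoc_of% this, eT]
      rw [S.map_comp, Category.assoc, reassoc_of% eS, hβ, reassoc_of% (α_mul g)]
  exact ⟨{ app := β, naturality := fun _ _ f => β_nat f, app_η := unit, app_μ := mul },
    fun f => by
      change f ≫ β _ = h.toFun f
      rw [β_ι, hα]⟩

end FPModel

namespace FPModel

variable {A : Type (v + 1)} [LargeCategory.{v} A] [IsLocallyFinitelyPresentable.{v} A]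
  (M : FPModel A)

lemma onHom_monadToTheory_map {S T : FinitaryMonad A} (θ : S ⟶ T) {a b : M.base}
    (f : M.ι.obj b.unop ⟶ S.obj.obj (M.ι.obj a.unop)) :
    IdOnObj.Mor.onHom (M.monadToTheory.map θ) (a := a) (b := b) f =
      (f ≫ θ.hom.app _ : M.ι.obj b.unop ⟶ T.obj.obj (M.ι.obj a.unop)) :=
  eq_of_heq (OneObjCat.toTheory_map_onHom_heq (M.toOneObj.map θ) f)

instance : M.monadToTheory.Faithful where
  map_injective {S T} θ θ' h := by
    have := S.property
    refine ObjectProperty.hom_ext _ (monadHom_ext (M := M) fun {i j} f => ?_)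
    exact (M.onHom_monadToTheory_map θ (a := op i) (b := op j) f).symm.trans
      ((congrArg (fun t => IdOnObj.Mor.onHom t (a := op i) (b := op j) f) h).trans
        (M.onHom_monadToTheory_map θ' (a := op i) (b := op j) f))

instance : M.monadToTheory.Full where
  map_surjective {S T} H := by
    have := S.property
    let h : KleisliMap M S.obj T.obj :=
      { toFun := fun {i j} f => IdOnObj.Mor.onHom H (a := op i) (b := op j) f
        unit := fun {i j} a => IdOnObj.Mor.onHom_map H (a := op i) (b := op j) a.op
        comp := fun {i j k} f g =>
          IdOnObj.Mor.onHom_comp H (a := op i) (b := op j) (c := op k) f g }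
    obtain ⟨θ, hθ⟩ := M.exists_monadHom h
    exact ⟨ObjectProperty.homMk θ, IdOnObj.Mor.ext_onHom fun {a b} f =>
      (M.onHom_monadToTheory_map (ObjectProperty.homMk θ) f).trans (hθ f)⟩

/-! ### The monad of a Lawvere theory -/

section

variable (L : LawvereTheory M.base)

/-- The restriction of a model to the base. -/
abbrev restrict : L.Model ⥤ M.carrierᵒᵖ ⥤ Type v :=
  ObjectProperty.ι _ ⋙ (Functor.whiskeringLeft _ _ _).obj L.J

lemma restrict_mem_essImage (N : L.Model) : M.nerve.essImage ((M.restrict L).obj N) := by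
  have : PreservesFiniteLimits ((M.restrict L).obj N) := N.property
  exact M.nerve_essImage _

/-- The forgetful functor from models of a Lawvere theory. -/
noncomputable def forget : L.Model ⥤ A :=
  Functor.essImage.liftFunctor (M.restrict L) M.nerve (M.restrict_mem_essImage L)

/-- Generalised elements of the underlying object of a model. -/
noncomputable def forgetIso : M.forget L ⋙ M.nerve ≅ M.restrict L :=
  Functor.essImage.liftFunctorCompIso _ _ _

lemma model_closed (K : Type v) [SmallCategory K] [IsFiltered K] :
    ObjectProperty.IsClosedUnderColimitsOfShape
      (fun F : L.Carrier ⥤ Type v => PreservesFiniteLimits (L.J ⋙ F)) K := by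
  have : ObjectProperty.IsClosedUnderColimitsOfShape
    (ObjectProperty.preservesFiniteLimits : ObjectProperty (M.base ⥤ Type v)) K := inferInstance
  exact inferInstanceAs (ObjectProperty.IsClosedUnderColimitsOfShape
    ((ObjectProperty.preservesFiniteLimits : ObjectProperty (M.base ⥤ Type v)).inverseImage
      ((Functor.whiskeringLeft _ _ _).obj L.J)) K)

instance : PreservesFilteredColimits (M.forget L) where
  preserves_filtered_colimits K _ _ := by
    have := M.model_closed L K
    have : PreservesColimitsOfShape K (M.restrict L) := inferInstance
    have : PreservesColimitsOfShape K (M.forget L ⋙ M.nerve) :=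
      preservesColimitsOfShape_of_natIso (M.forgetIso L).symm
    exact preservesColimitsOfShape_of_reflects_of_preserves _ M.nerve

variable {L}

/-- Generalised elements of the underlying object of a model. -/
noncomputable def forgetEquiv (i : M.carrier) (N : L.Model) :
    (M.ι.obj i ⟶ (M.forget L).obj N) ≃ N.obj.obj (L.J.obj (op i)) :=
  (((M.forgetIso L).app N).app (op i)).toEquiv

lemma forgetEquiv_map_comp {i j : M.carrier} (a : j ⟶ i) (N : L.Model)
    (x : M.ι.obj i ⟶ (M.forget L).obj N) :
    M.forgetEquiv j N (M.ι.map a ≫ x) = N.obj.map (L.J.map a.op) (M.forgetEquiv i N x) :=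
  ((M.forgetIso L).hom.app N).naturality_apply a.op x

lemma forgetEquiv_comp_map {i : M.carrier} {N N' : L.Model} (n : N ⟶ N')
    (x : M.ι.obj i ⟶ (M.forget L).obj N) :
    M.forgetEquiv i N' (x ≫ (M.forget L).map n) = n.hom.app _ (M.forgetEquiv i N x) :=
  congrArg (fun t => t.app (op i) x) ((M.forgetIso L).hom.naturality n)

variable (L) in
/-- The free model on a finitely presentable object. -/
def freeModel (i : M.carrier) : L.Model :=
  ⟨coyoneda.obj (op (L.J.obj (op i))), by
    have := L.lex
    infer_instance⟩

/-- Maps out of a free model. -/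
noncomputable def freeModelEquiv (i : M.carrier) (N : L.Model) :
    (M.freeModel L i ⟶ N) ≃ (M.ι.obj i ⟶ (M.forget L).obj N) :=
  (ObjectProperty.fullyFaithfulι _).homEquiv.trans
    (coyonedaEquiv.trans (M.forgetEquiv i N).symm)

lemma freeModelEquiv_comp {i : M.carrier} {N N' : L.Model} (f : M.freeModel L i ⟶ N)
    (n : N ⟶ N') :
    M.freeModelEquiv i N' (f ≫ n) = M.freeModelEquiv i N f ≫ (M.forget L).map n := by
  apply (M.forgetEquiv i N').injective
  rw [forgetEquiv_comp_map]
  refine (Equiv.apply_symm_apply _ _).trans (Eq.trans ?_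
    (congrArg _ (Equiv.apply_symm_apply (M.forgetEquiv i N) _).symm))
  rfl

instance : (M.forget L).IsRightAdjoint := by
  rw [Functor.isRightAdjoint_iff_leftAdjointObjIsDefined_eq_top]
  ext X
  simp only [Pi.top_apply, Prop.top_eq_true, iff_true]
  have := M.model_closed L (CostructuredArrow M.ι X)
  refine Functor.leftAdjointObjIsDefined_of_isColimit (M.isColimitCanonicalCocone X) fun x => ?_
  have c : (M.forget L ⋙ coyoneda.obj (op (M.ι.obj x.left))).CorepresentableBy
      (M.freeModel L x.left) :=
    { homEquiv := fun {N} => M.freeModelEquiv x.left N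
      homEquiv_comp := fun n f => M.freeModelEquiv_comp f n }
  exact c.isCorepresentable

variable (L) in
/-- The adjunction between free models and underlying objects. -/
noncomputable def freeForget : (M.forget L).leftAdjoint ⊣ M.forget L :=
  Adjunction.ofIsRightAdjoint _

variable (L) in
/-- The finitary monad of a Lawvere theory. -/
noncomputable def theoryMonad : FinitaryMonad A where
  obj := (M.freeForget L).toMonad
  property := by
    have : PreservesFilteredColimits (M.forget L).leftAdjoint :=
      ⟨fun _ _ _ => (M.freeForget L).leftAdjoint_preservesColimits.preservesColimitsOfShape⟩
    exact inferInstanceAs (PreservesFilteredColimits ((M.forget L).leftAdjoint ⋙ M.forget L))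

variable (L) in
/-- The free model on a finitely presentable object, as a value of the left adjoint. -/
noncomputable abbrev freeOn (i : M.carrier) : L.Model := (M.forget L).leftAdjoint.obj (M.ι.obj i)

variable (L) in
/-- The generators of the free model on a finitely presentable object. -/
noncomputable def generator (i : M.carrier) : (M.freeOn L i).obj.obj (L.J.obj (op i)) :=
  M.forgetEquiv i _ ((M.freeForget L).unit.app (M.ι.obj i))

lemma generator_bijective (i j : M.carrier) :
    Function.Bijective (fun y : L.J.obj (op i) ⟶ L.J.obj (op j) =>
      (M.freeOn L i).obj.map y (M.generator L i)) := by
  let κ : M.freeModel L i ⟶ M.freeOn L i :=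
    (M.freeModelEquiv i _).symm ((M.freeForget L).unit.app (M.ι.obj i))
  have : IsIso κ := by
    rw [isIso_iff_coyoneda_map_bijective]
    intro N
    rw [← Function.Bijective.of_comp_iff' (M.freeModelEquiv i N).bijective]
    have : (M.freeModelEquiv i N) ∘ (fun n : M.freeOn L i ⟶ N => κ ≫ n) =
        (M.freeForget L).homEquiv _ _ := funext fun n => by
      rw [Adjunction.homEquiv_unit]
      exact (M.freeModelEquiv_comp κ n).trans
        (congrArg (· ≫ _) (Equiv.apply_symm_apply (M.freeModelEquiv i _) _))
    rw [this]
    exact Equiv.bijective _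
  have : IsIso κ.hom := Functor.map_isIso (ObjectProperty.ι _) κ
  have : κ.hom = coyonedaEquiv.symm (M.generator L i) := by
    refine coyonedaEquiv.injective ((M.forgetEquiv i _).symm.injective ?_)
    refine (Equiv.apply_symm_apply (M.freeModelEquiv i (M.freeOn L i)) _).trans ?_
    rw [Equiv.apply_symm_apply]
    exact (Equiv.symm_apply_apply _ _).symm
  have hκ : (fun y => κ.hom.app (L.J.obj (op j)) y) =
      fun y : L.J.obj (op i) ⟶ L.J.obj (op j) =>
        (M.freeOn L i).obj.map y (M.generator L i) :=
    funext fun y => congrArg (fun t => t.app (L.J.obj (op j)) y) this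
  rw [← hκ]
  exact (isIso_iff_bijective (κ.hom.app (L.J.obj (op j)))).1 inferInstance

/-- The Kleisli morphism of a morphism of a Lawvere theory. -/
noncomputable def toKleisli {i j : M.carrier} (y : L.J.obj (op i) ⟶ L.J.obj (op j)) :
    M.ι.obj j ⟶ (M.theoryMonad L).obj.obj (M.ι.obj i) :=
  (M.forgetEquiv j _).symm ((M.freeOn L i).obj.map y (M.generator L i))

lemma forgetEquiv_toKleisli {i j : M.carrier} (y : L.J.obj (op i) ⟶ L.J.obj (op j)) :
    M.forgetEquiv j (M.freeOn L i) (M.toKleisli y) =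
      (M.freeOn L i).obj.map y (M.generator L i) :=
  Equiv.apply_symm_apply _ _

lemma toKleisli_map {i j : M.carrier} (a : j ⟶ i) :
    M.toKleisli (L.J.map a.op) = M.ι.map a ≫ (M.theoryMonad L).obj.η.app _ :=
  (Equiv.symm_apply_eq _).2 (M.forgetEquiv_map_comp a (M.freeOn L i) _).symm

lemma toKleisli_comp {i j k : M.carrier} (x : L.J.obj (op i) ⟶ L.J.obj (op j))
    (y : L.J.obj (op j) ⟶ L.J.obj (op k)) :
    M.toKleisli (x ≫ y) = M.toKleisli y ≫ (M.theoryMonad L).obj.map (M.toKleisli x) ≫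
      (M.theoryMonad L).obj.μ.app _ := by
  let f : M.freeOn L j ⟶ M.freeOn L i :=
    (M.forget L).leftAdjoint.map (M.toKleisli x) ≫ (M.freeForget L).counit.app (M.freeOn L i)
  have hf : (M.freeForget L).unit.app _ ≫ (M.forget L).map f = M.toKleisli x :=
    ((M.freeForget L).homEquiv_unit _ _ f).symm.trans
      ((congrArg _ ((M.freeForget L).homEquiv_counit _ _ (M.toKleisli x)).symm).trans
        (Equiv.apply_symm_apply _ _))
  have hT : (M.theoryMonad L).obj.map (M.toKleisli x) ≫ (M.theoryMonad L).obj.μ.app _ =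
      (M.forget L).map f := ((M.forget L).map_comp _ _).symm
  rw [hT]
  refine (Equiv.symm_apply_eq _).2 ((M.forgetEquiv_comp_map f (M.toKleisli y)).trans ?_).symm
  rw [forgetEquiv_toKleisli]
  refine (f.hom.naturality_apply y _).trans ?_
  have : f.hom.app _ (M.generator L j) = (M.freeOn L i).obj.map x (M.generator L i) :=
    (M.forgetEquiv_comp_map f _).symm.trans ((congrArg _ hf).trans (M.forgetEquiv_toKleisli x))
  rw [this]
  exact (congrArg (fun t => t (M.generator L i)) ((M.freeOn L i).obj.map_comp x y)).symm

instance : M.monadToTheory.EssSurj where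
  mem_essImage L := by
    let F : L ⟶ M.monadToTheory.obj (M.theoryMonad L) := IdOnObj.Mor.ofHom
      (fun {a b} y => M.toKleisli (i := a.unop) (j := b.unop) y)
      (fun φ => M.toKleisli_map φ.unop)
      (fun {a b c} x y => M.toKleisli_comp (i := a.unop) (j := b.unop) (k := c.unop) x y)
    refine ⟨M.theoryMonad L, ⟨(LawvereTheory.isoOfBijective F fun a b => ?_).symm⟩⟩
    have : (fun y : L.J.obj a ⟶ L.J.obj b => IdOnObj.Mor.onHom F y) =
        fun y => M.toKleisli (i := a.unop) (j := b.unop) y :=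
      funext fun y => IdOnObj.Mor.onHom_ofHom _ _ _ y
    change Function.Bijective (fun y : L.J.obj a ⟶ L.J.obj b => IdOnObj.Mor.onHom F y)
    rw [this]
    exact (M.forgetEquiv b.unop _).symm.bijective.comp (M.generator_bijective a.unop b.unop)

end

instance : M.monadToTheory.IsEquivalence where

instance : M.toOneObj.IsEquivalence :=
  have : (M.toOneObj ⋙ OneObjCat.toTheory M.base).IsEquivalence :=
    inferInstanceAs M.monadToTheory.IsEquivalence
  Functor.isEquivalence_of_comp_right _ (OneObjCat.toTheory M.base)

end FPModel

/-! ### Strictly natural transformations -/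

section

open Bicategory

variable {B : Type*} [Bicategory B]

lemma whiskerRight_comp_eq_of_eq_id {a b c d : B} {f : a ⟶ b} {g : b ⟶ d} {h : a ⟶ c} {k : c ⟶ d}
    {σ : f ⟶ f} {τ : k ⟶ k} (e : f ≫ g ⟶ h ≫ k) (hσ : σ = 𝟙 f) (hτ : τ = 𝟙 k) :
    σ ▷ g ≫ e = e ≫ h ◁ τ := by
  simp [hσ, hτ]

variable [Bicategory.Strict B]

lemma strict_naturality_id {a b : B} {f : a ⟶ a} {g : b ⟶ b} (h : a ⟶ b) (hf : f = 𝟙 a)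
    (hg : g = 𝟙 b) (e : f ≫ h = h ≫ g) :
    (eqToIso e).hom ≫ h ◁ (eqToIso hg).hom =
      (eqToIso hf).hom ▷ h ≫ (λ_ h).hom ≫ (ρ_ h).inv := by
  simp [Strict.leftUnitor_eqToIso, Strict.rightUnitor_eqToIso]

lemma strict_naturality_comp {a b c a' b' c' : B} {f : a ⟶ b} {g : b ⟶ c} {f' : a' ⟶ b'}
    {g' : b' ⟶ c'} {k : a ⟶ c} {k' : a' ⟶ c'} (p : a ⟶ a') (q : b ⟶ b') (r : c ⟶ c')
    (hk : k = f ≫ g) (hk' : k' = f' ≫ g') (e : k ≫ r = p ≫ k') (ef : f ≫ q = p ≫ f')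
    (eg : g ≫ r = q ≫ g') :
    (eqToIso e).hom ≫ p ◁ (eqToIso hk').hom =
      (eqToIso hk).hom ▷ r ≫ (α_ _ _ _).hom ≫ f ◁ (eqToIso eg).hom ≫
        (α_ _ _ _).inv ≫ (eqToIso ef).hom ▷ g' ≫ (α_ _ _ _).hom := by
  simp [Strict.associator_eqToIso]

/-- A strictly natural transformation between functors to a strict bicategory, as a strong
transformation. -/
def strongTransOfNatTrans {I : Type*} [Category I] {F G : I ⥤ B} (α : F ⟶ G) :
    Pseudofunctor.StrongTrans F.toPseudofunctor' G.toPseudofunctor' where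
  app a := α.app a.as
  naturality f := eqToIso (α.naturality f.as)
  naturality_naturality {a b f g} η := by
    obtain rfl := LocallyDiscrete.eq_of_hom η
    obtain rfl : η = 𝟙 _ := Subsingleton.elim _ _
    exact whiskerRight_comp_eq_of_eq_id _ (F.toPseudofunctor'.map₂_id f)
      (G.toPseudofunctor'.map₂_id f)
  naturality_id a := strict_naturality_id (α.app a.as) (F.map_id a.as) (G.map_id a.as)
    (α.naturality (𝟙 a.as))
  naturality_comp f g := strict_naturality_comp (α.app _) (α.app _) (α.app _)
    (F.map_comp f.as g.as) (G.map_comp f.as g.as) (α.naturality (f.as ≫ g.as))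
    (α.naturality f.as) (α.naturality g.as)

end

/-! ### Algebras and models -/

namespace LawvereTheory

variable {A : FLCat.{v}}

lemma functor_model_ext {C : Type*} [Category C] {L : LawvereTheory A} {F G : C ⥤ L.Model}
    (hobj : ∀ X a, (F.obj X).obj.obj a = (G.obj X).obj.obj a)
    (hmap : ∀ X {a b : A} (f : L.J.obj a ⟶ L.J.obj b),
      HEq ((F.obj X).obj.map f) ((G.obj X).obj.map f))
    (h : ∀ {X Y} (f : X ⟶ Y) a, HEq ((F.map f).hom.app a) ((G.map f).hom.app a)) : F = G := by
  have hF : F ⋙ ObjectProperty.ι _ = G ⋙ ObjectProperty.ι _ := by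
    have h₀ : ∀ X, (F.obj X).obj = (G.obj X).obj := fun X =>
      CategoryTheory.Functor.hext (hobj X) (fun a b f => hmap X f)
    refine CategoryTheory.Functor.hext h₀ fun X Y f => ?_
    have : ∀ {P Q P' Q' : L.Carrier ⥤ Type v} (s : P ⟶ Q) (t : P' ⟶ Q'), P = P' → Q = Q' →
        (∀ a, HEq (s.app a) (t.app a)) → HEq s t := by
      rintro P Q _ _ s t rfl rfl h
      exact heq_of_eq (NatTrans.ext (funext fun a => eq_of_heq (h a)))
    exact this _ _ (h₀ X) (h₀ Y) (h f)
  have e : ∀ H : C ⥤ L.Model, H = ObjectProperty.lift _ (H ⋙ ObjectProperty.ι _)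
    (fun X => (H.obj X).property) := fun H => rfl
  rw [e F, e G]
  congr 1

end LawvereTheory

namespace FPModel

variable {A : Type (v + 1)} [LargeCategory.{v} A]

lemma algebra_comp {T : Monad A} (X : T.Algebra) {Y Z W : A} (h : W ⟶ T.obj Z)
    (g : Z ⟶ T.obj Y) (x : Y ⟶ X.A) :
    (h ≫ T.map g ≫ T.μ.app Y) ≫ T.map x ≫ X.a = h ≫ T.map (g ≫ T.map x ≫ X.a) ≫ X.a := by
  have := T.μ.naturality x
  dsimp at this
  simp only [Category.assoc, Functor.map_comp, ← X.assoc, reassoc_of% this]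

lemma algebra_unit {T : Monad A} (X : T.Algebra) {Y Z : A} (a : Z ⟶ Y) (x : Y ⟶ X.A) :
    (a ≫ T.η.app Y) ≫ T.map x ≫ X.a = a ≫ x := by
  have := T.η.naturality x
  dsimp at this
  rw [Category.assoc, ← reassoc_of% this, X.unit]
  exact congrArg _ (Category.comp_id x)

lemma algebra_hom_comp {T : Monad A} {X X' : T.Algebra} (h : X ⟶ X') {Y W : A}
    (f : W ⟶ T.obj Y) (x : Y ⟶ X.A) :
    (f ≫ T.map x ≫ X.a) ≫ h.f = f ≫ T.map (x ≫ h.f) ≫ X'.a := by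
  simp

lemma algebra_restrict {S T : Monad A} (θ : S ⟶ T) (X : T.Algebra) {Y W : A} (f : W ⟶ S.obj Y)
    (x : Y ⟶ X.A) :
    f ≫ S.map x ≫ θ.app X.A ≫ X.a = (f ≫ θ.app Y) ≫ T.map x ≫ X.a := by
  simp

variable [IsLocallyFinitelyPresentable.{v} A] (M : FPModel A)

/-- The functor on the Lawvere theory of a monad induced by an algebra. -/
def comparisonObj (T : FinitaryMonad A) (X : T.obj.Algebra) :
    (M.monadToTheory.obj T).Carrier ⥤ Type v where
  obj b := M.ι.obj (Opposite.unop (α := M.carrier) b) ⟶ X.A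
  map {a b} (f : M.ι.obj (Opposite.unop (α := M.carrier) b) ⟶
      T.obj.obj (M.ι.obj (Opposite.unop (α := M.carrier) a))) :=
    ↾(fun x => f ≫ T.obj.map x ≫ X.a)
  map_id b := by
    ext x
    refine (congrArg (fun t => (t ≫ _) ≫ _) (M.ι.map_id _)).trans ?_
    refine (algebra_unit X _ x).trans (Category.id_comp _)
  map_comp f g := by
    ext x
    exact algebra_comp X _ _ x

/-- Restricting the functor induced by an algebra to the base gives the generalised elements of its
underlying object. -/
def comparisonObjIso (T : FinitaryMonad A) (X : T.obj.Algebra) :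
    M.nerve.obj X.A ≅ (M.monadToTheory.obj T).J ⋙ M.comparisonObj T X :=
  NatIso.ofComponents (fun _ => Iso.refl _) (fun {i j} φ => by
    ext x
    exact (algebra_unit X (M.ι.map φ.unop) x).symm)

/-- The comparison between algebras for a monad and models of its Lawvere theory. -/
def comparison (T : FinitaryMonad A) : T.obj.Algebra ⥤ (M.monadToTheory.obj T).Model where
  obj X := ⟨M.comparisonObj T X, by
    have := M.nerve_obj_preservesFiniteLimits X.A
    exact preservesFiniteLimits_of_natIso (M.comparisonObjIso T X)⟩
  map {X Y} h := ObjectProperty.homMk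
    { app := fun b => ↾(fun x => (x : _ ⟶ X.A) ≫ h.f)
      naturality := fun a b f => by
        ext x
        exact algebra_hom_comp h (W := M.ι.obj (Opposite.unop (α := M.carrier) b))
          (Y := M.ι.obj (Opposite.unop (α := M.carrier) a)) f x }
  map_id X := by
    ext b (x : M.ι.obj _ ⟶ X.A)
    exact Category.comp_id x
  map_comp {X Y Z} _ _ := by
    ext b (x : M.ι.obj _ ⟶ X.A)
    exact (Category.assoc x _ _).symm

instance (T : FinitaryMonad A) : (M.comparison T).Faithful where
  map_injective {X Y _ _} e := Monad.Algebra.Hom.ext (hom_ext (M := M) fun i x =>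
    congrArg (fun t : (M.comparison T).obj X ⟶ (M.comparison T).obj Y => t.hom.app (op i) x) e)

instance (T : FinitaryMonad A) : (M.comparison T).Full where
  map_surjective {X Y} t := by
    have := T.property
    let s : ∀ {i : M.carrier}, (M.ι.obj i ⟶ X.A) → (M.ι.obj i ⟶ Y.A) :=
      fun {i} x => t.hom.app (op i) x
    have hs : ∀ {i j : M.carrier} (f : M.ι.obj j ⟶ T.obj.obj (M.ι.obj i)) (x : M.ι.obj i ⟶ X.A),
        s (f ≫ T.obj.map x ≫ X.a) = f ≫ T.obj.map (s x) ≫ Y.a :=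
      fun {i j} f x => t.hom.naturality_apply
        (X := (M.monadToTheory.obj T).J.obj (op i)) (Y := (M.monadToTheory.obj T).J.obj (op j)) f x
    obtain ⟨h, hh⟩ := M.exists_hom (X := X.A) (Y := Y.A) s (fun {i j} a x => by
      have := hs (M.ι.map a ≫ T.obj.η.app _) x
      rwa [algebra_unit, algebra_unit] at this)
    refine ⟨Monad.Algebra.Hom.mk h (map_hom_ext (M := M) (T.obj : A ⥤ A) fun i x =>
      hom_ext (M := M) fun j f => ?_), ?_⟩
    · have := hh (f ≫ T.obj.map x ≫ X.a)
      rw [hs, ← hh x] at this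
      simpa using this.symm
    · ext b x
      exact hh x

/-- An algebra structure is determined by its action on finitely presentable objects. -/
lemma exists_algebra (T : FinitaryMonad A) {X : A}
    (act : ∀ {i j : M.carrier}, (M.ι.obj j ⟶ T.obj.obj (M.ι.obj i)) → (M.ι.obj i ⟶ X) →
      (M.ι.obj j ⟶ X))
    (act_unit : ∀ {i j : M.carrier} (a : j ⟶ i) (x : M.ι.obj i ⟶ X),
      act (M.ι.map a ≫ T.obj.η.app _) x = M.ι.map a ≫ x)
    (act_comp : ∀ {i j k : M.carrier} (f : M.ι.obj j ⟶ T.obj.obj (M.ι.obj i))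
      (g : M.ι.obj k ⟶ T.obj.obj (M.ι.obj j)) (x : M.ι.obj i ⟶ X),
      act (g ≫ T.obj.map f ≫ T.obj.μ.app _) x = act g (act f x)) :
    ∃ (a : T.obj.obj X ⟶ X) (_ : T.obj.η.app X ≫ a = 𝟙 X)
      (_ : T.obj.μ.app X ≫ a = T.obj.map a ≫ a),
      ∀ {i j : M.carrier} (f : M.ι.obj j ⟶ T.obj.obj (M.ι.obj i)) (x : M.ι.obj i ⟶ X),
        f ≫ T.obj.map x ≫ a = act f x := by
  have := T.property
  have comp_act : ∀ {i j k : M.carrier} (b : k ⟶ j) (f : M.ι.obj j ⟶ T.obj.obj (M.ι.obj i))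
      (x : M.ι.obj i ⟶ X), act (M.ι.map b ≫ f) x = M.ι.map b ≫ act f x := fun b f x => by
    rw [← act_unit b, ← act_comp]
    exact congrArg (act · x) (algebra_unit (T.obj.free.obj _) (M.ι.map b) f).symm
  have act_map : ∀ {i j k : M.carrier} (f : M.ι.obj k ⟶ T.obj.obj (M.ι.obj j)) (b : j ⟶ i)
      (x : M.ι.obj i ⟶ X), act (f ≫ T.obj.map (M.ι.map b)) x = act f (M.ι.map b ≫ x) :=
    fun f b x => by
      rw [← act_unit b, ← act_comp]
      simp
  choose α hα using fun (i : M.carrier) (x : M.ι.obj i ⟶ X) =>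
    M.exists_hom (X := T.obj.obj (M.ι.obj i)) (Y := X) (fun f => act f x)
      (fun b f => comp_act b f x)
  obtain ⟨a, ha⟩ := M.exists_desc (X := X) (Y := X) (T.obj : A ⥤ A) (fun {i} x => α i x)
    (fun {i j} b x => hom_ext (M := M) fun k f => by
      rw [hα, ← act_map, ← hα, Category.assoc])
  have key : ∀ {i j : M.carrier} (f : M.ι.obj j ⟶ T.obj.obj (M.ι.obj i)) (x : M.ι.obj i ⟶ X),
      f ≫ T.obj.map x ≫ a = act f x := fun f x => by rw [ha, hα]
  refine ⟨a, hom_ext (M := M) fun i x => ?_, map_hom_ext (M := M) (T.obj : A ⥤ A) fun j g =>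
    hom_ext (M := M) fun k f => ?_, key⟩
  · have := key (M.ι.map (𝟙 i) ≫ T.obj.η.app _) x
    rw [act_unit] at this
    have e : T.obj.η.app _ ≫ T.obj.map x = x ≫ T.obj.η.app X := (T.obj.η.naturality x).symm
    rw [M.ι.map_id, Category.id_comp, Category.id_comp, reassoc_of% e] at this
    rw [this]
    exact (Category.comp_id x).symm
  · obtain ⟨i, x, g, rfl⟩ := M.exists_factor (T.obj : A ⥤ A) g
    have e : T.obj.map (T.obj.map x) ≫ T.obj.μ.app X = T.obj.μ.app _ ≫ T.obj.map x :=
      T.obj.μ.naturality x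
    have h := key (f ≫ T.obj.map g ≫ T.obj.μ.app _) x
    rw [act_comp, ← key f, ← key g] at h
    simpa [reassoc_of% e] using h

instance (T : FinitaryMonad A) : (M.comparison T).EssSurj where
  mem_essImage N := by
    let L := M.monadToTheory.obj T
    let X := (M.forget L).obj N
    let σ : ∀ i : M.carrier, (M.ι.obj i ⟶ X) ≃ N.obj.obj (L.J.obj (op i)) :=
      fun i => M.forgetEquiv i N
    let app : ∀ {i j : M.carrier}, (M.ι.obj j ⟶ T.obj.obj (M.ι.obj i)) →
        N.obj.obj (L.J.obj (op i)) → N.obj.obj (L.J.obj (op j)) := fun {i j} f =>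
      N.obj.map (X := L.J.obj (op i)) (Y := L.J.obj (op j)) f
    obtain ⟨a, unit, assoc, h⟩ := M.exists_algebra T (X := X)
      (fun {i j} f x => (σ j).symm (app f (σ i x)))
      (fun {i j} a x => (Equiv.symm_apply_eq _).2 (M.forgetEquiv_map_comp a N x).symm)
      (fun {i j k} f g x => by
        rw [Equiv.apply_symm_apply]
        exact congrArg (fun t => (σ k).symm (t (σ i x))) (N.obj.map_comp (X := L.J.obj (op i))
          (Y := L.J.obj (op j)) (Z := L.J.obj (op k)) f g))
    let X' : T.obj.Algebra := { A := X, a := a, unit := unit, assoc := assoc }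
    refine ⟨X', ⟨ObjectProperty.isoMk _ (NatIso.ofComponents (fun b => (σ _).toIso) ?_)⟩⟩
    intro b c f
    ext x
    exact ((Equiv.symm_apply_eq _).1 (h f x).symm).symm

instance (T : FinitaryMonad A) : (M.comparison T).IsEquivalence where

/-- The comparisons between algebras and models are natural in the monad. -/
def comparisonNatTrans : alg A ⟶ M.monadToTheory.op ⋙ LawvereTheory.mod M.base where
  app T := (M.comparison T.unop).toCatHom
  naturality S T θ := by
    refine Cat.ext (LawvereTheory.functor_model_ext (fun _ _ => rfl) (fun X {a b} f => ?_)
      (fun _ _ => HEq.rfl))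
    refine heq_of_eq ?_
    ext x
    have h : (IdOnObj.Mor.functor (M.monadToTheory.map θ.unop)).map f =
        (f ≫ θ.unop.hom.app _ : M.ι.obj b.unop ⟶ S.unop.obj.obj (M.ι.obj a.unop)) :=
      ((Category.id_comp _).trans (Category.comp_id _)).symm.trans
        (M.onHom_monadToTheory_map θ.unop (a := a) (b := b) f)
    refine Eq.trans ?_ (congrArg (fun t : M.ι.obj b.unop ⟶ S.unop.obj.obj (M.ι.obj a.unop) =>
      t ≫ S.unop.obj.map x ≫ X.a) h).symm
    exact algebra_restrict θ.unop.hom X (Y := M.ι.obj a.unop) f x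

end FPModel

end LexEnriched

theorem mainTheorem1 {A : Type (v + 1)} [LargeCategory.{v} A]
    [IsLocallyFinitelyPresentable.{v} A] (M : FPModel A) :
    (∀ T : OneObjCat M.base, (unitΓ T.cat).IsFreeAbsoluteCompletion) ∧
    M.toOneObj.IsEquivalence ∧
    (OneObjCat.toLawvere M.base).IsEquivalence ∧
    (LawvereLexProfCat.toLawvereTheory M.base).IsEquivalence ∧
    M.monadToTheory.IsEquivalence ∧
    ∃ α : Pseudofunctor.StrongTrans (alg A).toPseudofunctor'
        (M.monadToTheory.op ⋙ LawvereTheory.mod M.base).toPseudofunctor',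
      ∀ T, (α.app T).toFunctor.IsEquivalence := by
  exact ⟨fun T => unitΓ_isFreeAbsoluteCompletion T.cat, inferInstance, inferInstance, inferInstance,
    inferInstance, strongTransOfNatTrans M.comparisonNatTrans, fun T =>
      inferInstanceAs (M.comparison T.as.unop).IsEquivalence⟩
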